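/- Let $X$ be a finite CW-complex. A continuous closed 1-form $\omega$ on $X$ is a family of continuous functions $f_U:U\to\mathbb R$, indexed by the members of an open cover $\mathcal U$ of $X$, such that $f_U-f_V$ is locally constant on $U\cap V$ for all $U,V\in\mathcal U$. For a path $\gamma:[0,1]\to X$ put $\int_\gamma\omega=\sum_{i=0}^{n-1}\bigl(f_{U_i}(\gamma(t_{i+1}))-f_{U_i}(\gamma(t_i))\bigr)$, where $0=t_0\le\dots\le t_n=1$ is any subdivision with $\gamma([t_i,t_{i+1}])\subseteq U_i\in\mathcal U$. The class $[\omega]\in H^1(X;\mathbb R)$ (singular cohomology) is that of the cocycle $\gamma\mapsto\int_\gamma\omega$. For $\xi\in H^1(X;\mathbb R)$, $\operatorname{cat}(X,\xi)$ is the least integer $k\ge 0$ such that for every integer $N>0$ there is an open cover $X=F\cup F_1\cup\dots\cup F_k$ for which each inclusion $F_j\to X$ is null-homotopic and there is a homotopy $h_t:F\to X$, $t\in[0,1]$, starting at the inclusion $h_0$, with $\int_{\gamma_x}\omega\le -N$ for all $x\in F$, where $\gamma_x(t)=h_t(x)$ and $\omega$ is a continuous closed 1-form representing $\xi$ (the choice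 of $\omega$ is immaterial). A gradient-like flow of $\omega$ is a continuous flow $\varphi:X\times\mathbb R\to X$ such that each $f_U$ is strictly decreasing along every piece of a trajectory that lies in $U$ and does not consist of a fixed point. A zero of $\omega$ is a point that is fixed by every gradient-like flow of $\omega$. A homoclinic cycle of $\varphi$ is a finite sequence of non-constant trajectories $\gamma_1,\dots,\gamma_n$ ($n\ge1$) of $\varphi$ with points $p_i\in X$ such that $\lim_{t\to+\infty}\gamma_i(t)=p_{i+1}=\lim_{t\to-\infty}\gamma_{i+1}(t)$ for all $i$, with indices modulo $n$. Let $\omega$ be a continuous closed 1-form on $X$ and $\xi=[\omega]\in H^1(X;\mathbb R)$. (1) Suppose that $\omega$ has exactly $k$ zeros $p_1,\dots,p_k$, where $k<\infty$. If $k<\operatorname{cat}(X,\xi)$, then every gradient-like flow of $\omega$ whose set of fixed points is $\{p_1,\dots,p_k\}$ has a homoclinic cycle. (2) If $\omega$ admits a gradient-like flow with only finitely many fixed points and with no homoclinic cycles, then $\omega$ has at least $\operatorname{cat}(X,\xi)$ distinct zeros. -/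

import Mathlib

noncomputable section

namespace LSForm

open Topology unitInterval

universe u

/-- A continuous closed 1-form on `X`: a family of continuous functions `f_U : U → ℝ`, indexed by
the members `U` of an open cover of `X`, whose differences on overlaps are locally constant. -/
structure ClosedOneForm (X : Type u) [TopologicalSpace X] where
  cover : Set (TopologicalSpace.Opens X)
  covers : ∀ x : X, ∃ U ∈ cover, x ∈ U
  fn : ∀ U : cover, C(U.1, ℝ)
  locConst : ∀ U V : cover, IsLocallyConstant
    (fun x : (U.1 ⊓ V.1 : TopologicalSpace.Opens X) => fn U ⟨x.1, x.2.1⟩ - fn V ⟨x.1, x.2.2⟩)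

variable {X : Type u} [TopologicalSpace X]

namespace ClosedOneForm

open Classical in
/-- The value `f_U(x)` for `x ∈ U`; the value for `x ∉ U` is irrelevant. -/
def val (ω : ClosedOneForm X) (U : ω.cover) (x : X) : ℝ :=
  if h : x ∈ U.1 then ω.fn U ⟨x, h⟩ else 0

/-- `a` is the sum `∑ [f_{U_i}(γ(t_{i+1})) - f_{U_i}(γ(t_i))]` for some subdivision
`0 = t_0 ≤ ⋯ ≤ t_n = 1` with `γ [t_i, t_{i+1}] ⊆ U_i`. -/
def IsIntegral (ω : ClosedOneForm X) (γ : C(I, X)) (a : ℝ) : Prop :=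
  ∃ (n : ℕ) (t : ℕ → I) (U : ℕ → ω.cover), Monotone t ∧ t 0 = 0 ∧ t n = 1 ∧
    (∀ i < n, ∀ s ∈ Set.Icc (t i) (t (i + 1)), γ s ∈ (U i).1) ∧
    a = ∑ i ∈ Finset.range n, (ω.val (U i) (γ (t (i + 1))) - ω.val (U i) (γ (t i)))

theorem exists_isIntegral (ω : ClosedOneForm X) (γ : C(I, X)) : ∃ a, ω.IsIntegral γ a := by
  obtain ⟨t, ht0, htm, ⟨n, hn⟩, ht⟩ := exists_monotone_Icc_subset_open_cover_unitInterval
    (c := fun U : ω.cover => γ ⁻¹' (U.1 : Set X))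
    (fun U => U.1.isOpen.preimage γ.continuous)
    (fun s _ => by
      obtain ⟨U, hU, hs⟩ := ω.covers (γ s)
      exact Set.mem_iUnion.2 ⟨⟨U, hU⟩, hs⟩)
  choose U hU using ht
  exact ⟨_, n, t, U, htm, ht0, hn n le_rfl, fun i _ s hs => hU i hs, rfl⟩

theorem val_sub_eventually (ω : ClosedOneForm X) (U V : ω.cover) (x : X) (hU : x ∈ U.1)
    (hV : x ∈ V.1) :
    ∀ᶠ y in 𝓝 x, ω.val U y - ω.val U x = ω.val V y - ω.val V x := by
  have h := (IsLocallyConstant.iff_eventually_eq _).1 (ω.locConst U V) ⟨x, hU, hV⟩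
  have ho : IsOpen ((U.1 ⊓ V.1 : TopologicalSpace.Opens X) : Set X) := (U.1 ⊓ V.1).isOpen
  rw [show (𝓝 (⟨x, hU, hV⟩ : (U.1 ⊓ V.1 : TopologicalSpace.Opens X))) = _ from
    nhds_subtype_eq_comap, Filter.eventually_comap] at h
  filter_upwards [h, ho.mem_nhds (show x ∈ _ from ⟨hU, hV⟩)] with y hy hyo
  have h2 := hy ⟨y, hyo⟩ rfl
  have h3 : y ∈ U.1 := hyo.1
  have h4 : y ∈ V.1 := hyo.2
  simp only [val, hU, hV, h3, h4, dif_pos]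
  linarith

theorem sum_clamp (H : I → ℝ) (t : ℕ → I) (ht : Monotone t) (h0 : t 0 = 0) (s : I) (n : ℕ) :
    ∑ i ∈ Finset.range n, (H (max (t i) (min s (t (i + 1)))) - H (t i)) =
      H (min s (t n)) - H 0 := by
  induction n with
  | zero => simp [h0]
  | succ n ih =>
    rw [Finset.sum_range_succ, ih]
    have h1 : t n ≤ t (n + 1) := ht (Nat.le_succ n)
    rcases le_total s (t n) with h | h
    · have h2 : s ≤ t (n + 1) := h.trans h1
      simp [min_eq_left h, min_eq_left h2, max_eq_left h]
    · have h2 : t n ≤ min s (t (n + 1)) := le_min h h1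
      rw [min_eq_right h, max_eq_right h2]
      ring

/-- Every value of a subdivision sum is the increment of a primitive of `γ^* ω` on `[0,1]`. -/
theorem IsIntegral.exists_primitive {ω : ClosedOneForm X} {γ : C(I, X)} {a : ℝ}
    (h : ω.IsIntegral γ a) :
    ∃ g : I → ℝ, g 1 - g 0 = a ∧ ∀ (s : I) (V : ω.cover), γ s ∈ V.1 →
      ∀ᶠ s' in 𝓝 s, g s' - g s = ω.val V (γ s') - ω.val V (γ s) := by
  obtain ⟨n, t, U, ht, h0, h1, hU, rfl⟩ := h
  let cl : ℕ → I → I := fun i s => max (t i) (min s (t (i + 1)))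
  have hcl : ∀ i, Continuous (cl i) := fun i => by fun_prop
  refine ⟨fun s => ∑ i ∈ Finset.range n, (ω.val (U i) (γ (cl i s)) - ω.val (U i) (γ (t i))),
    ?_, ?_⟩
  · rw [← Finset.sum_sub_distrib]
    refine Finset.sum_congr rfl fun i _ => ?_
    have h2 : cl i 1 = t (i + 1) := by
      simp [cl, min_eq_right (le_one' (t := t (i+1))), ht (Nat.le_succ i)]
    have h3 : cl i 0 = t i := by
      simp [cl]
    rw [h2, h3]; ring
  · intro s V hV
    have key : ∀ i ∈ Finset.range n, ∀ᶠ s' in 𝓝 s,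
        ω.val (U i) (γ (cl i s')) - ω.val (U i) (γ (cl i s)) =
          ω.val V (γ (cl i s')) - ω.val V (γ (cl i s)) := by
      intro i hi
      by_cases hs : s ∈ Set.Icc (t i) (t (i + 1))
      · have hcs : cl i s = s := by simp [cl, hs.1, hs.2]
        have h2 := ω.val_sub_eventually (U i) V (γ s) (hU i (Finset.mem_range.1 hi) s hs) hV
        have h3 : Filter.Tendsto (fun s' => γ (cl i s')) (𝓝 s) (𝓝 (γ s)) := by
          have := (γ.continuous.comp (hcl i)).tendsto s
          simpa [Function.comp_def, hcs] using this
        rw [hcs]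
        exact h3.eventually h2
      · have : ∀ᶠ s' in 𝓝 s, cl i s' = cl i s := by
          rw [Set.mem_Icc, not_and_or, not_le, not_le] at hs
          rcases hs with hs | hs
          · filter_upwards [Iio_mem_nhds hs] with s' hs'
            have e1 : min s' (t (i+1)) ≤ t i := (min_le_left _ _).trans (le_of_lt hs')
            have e2 : min s (t (i+1)) ≤ t i := (min_le_left _ _).trans hs.le
            simp only [cl, max_eq_left e1, max_eq_left e2]
          · filter_upwards [Ioi_mem_nhds hs] with s' hs'
            have e1 : t (i+1) ≤ s' := le_of_lt hs'
            simp only [cl, min_eq_right e1, min_eq_right hs.le]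
        filter_upwards [this] with s' hs'
        rw [hs']; ring
    have key' := (Filter.eventually_all_finset (Finset.range n)).2 key
    filter_upwards [key'] with s' hs'
    have e := sum_clamp (fun r => ω.val V (γ r)) t ht h0
    have e1 := e s' n
    have e2 := e s n
    rw [h1, min_eq_left le_one'] at e1 e2
    rw [← Finset.sum_sub_distrib]
    rw [← sub_sub_sub_cancel_right _ _ (ω.val V (γ 0)), ← e1, ← e2, ← Finset.sum_sub_distrib]
    refine Finset.sum_congr rfl fun i hi => ?_
    have := hs' i hi
    simp only [cl] at this ⊢
    linarith

theorem IsIntegral.unique {ω : ClosedOneForm X} {γ : C(I, X)} {a b : ℝ}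
    (ha : ω.IsIntegral γ a) (hb : ω.IsIntegral γ b) : a = b := by
  obtain ⟨g, hg, hg'⟩ := ha.exists_primitive
  obtain ⟨k, hk, hk'⟩ := hb.exists_primitive
  have hlc : IsLocallyConstant (fun s => g s - k s) := by
    rw [IsLocallyConstant.iff_eventually_eq]
    intro s
    obtain ⟨V, hV, hs⟩ := ω.covers (γ s)
    filter_upwards [hg' s ⟨V, hV⟩ hs, hk' s ⟨V, hV⟩ hs] with s' h1 h2
    linarith
  have := hlc.apply_eq_of_isPreconnected isPreconnected_univ (Set.mem_univ 1) (Set.mem_univ 0)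
  linarith

/-- The integral `∫_γ ω`. -/
def integral (ω : ClosedOneForm X) (γ : C(I, X)) : ℝ :=
  Classical.choose (ω.exists_isIntegral γ)

theorem integral_spec (ω : ClosedOneForm X) (γ : C(I, X)) : ω.IsIntegral γ (ω.integral γ) :=
  Classical.choose_spec (ω.exists_isIntegral γ)

theorem integral_eq {ω : ClosedOneForm X} {γ : C(I, X)} {a : ℝ} (h : ω.IsIntegral γ a) :
    ω.integral γ = a :=
  (ω.integral_spec γ).unique h

end ClosedOneForm

section Cohomology

/-- Singular `n`-simplices of `X`. -/
abbrev Simplex (X : Type u) [TopologicalSpace X] (n : ℕ) : Type u :=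
  C(stdSimplex ℝ (Fin (n + 1)), X)

/-- The `i`-th face inclusion of the standard simplex. -/
def faceMap (n : ℕ) (i : Fin (n + 2)) :
    C(stdSimplex ℝ (Fin (n + 1)), stdSimplex ℝ (Fin (n + 2))) :=
  ⟨stdSimplex.map i.succAbove, stdSimplex.continuous_map _⟩

/-- The singular coboundary `(δc)(s) = ∑ᵢ (-1)ⁱ c(s ∘ dᵢ)` on real singular cochains. -/
def coboundary (X : Type u) [TopologicalSpace X] (n : ℕ) :
    (Simplex X n → ℝ) →ₗ[ℝ] (Simplex X (n + 1) → ℝ) where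
  toFun c s := ∑ i : Fin (n + 2), (-1 : ℝ) ^ (i : ℕ) * c (s.comp (faceMap n i))
  map_add' c d := by
    funext s
    simp [mul_add, Finset.sum_add_distrib]
  map_smul' r c := by
    funext s
    simp [Finset.mul_sum, mul_left_comm]

/-- Real singular 1-cocycles. -/
abbrev Cocycle (X : Type u) [TopologicalSpace X] : Submodule ℝ (Simplex X 1 → ℝ) :=
  LinearMap.ker (coboundary X 1)

/-- The singular cohomology group `H¹(X; ℝ)`: cocycles modulo coboundaries. -/
abbrev H1 (X : Type u) [TopologicalSpace X] : Type u :=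
  Cocycle X ⧸ (LinearMap.range (coboundary X 0)).comap (Cocycle X).subtype

/-- A singular 1-simplex viewed as a path on `[0,1]`, from its vertex `0` to its vertex `1`. -/
def Simplex.toPath (s : Simplex X 1) : C(I, X) :=
  s.comp ⟨stdSimplexHomeomorphUnitInterval.symm, stdSimplexHomeomorphUnitInterval.symm.continuous⟩

/-- `[ω] = ξ`: the class `ξ` is that of the cocycle `s ↦ ∫_s ω`. -/
def ClosedOneForm.Represents (ω : ClosedOneForm X) (ξ : H1 X) : Prop :=
  ∃ c : Cocycle X, (∀ s : Simplex X 1, c.1 s = ω.integral s.toPath) ∧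
    Submodule.Quotient.mk c = ξ

end Cohomology

section Category

/-- The curve `t ↦ h_t(x)` traced by `x` under a homotopy `h : F × [0,1] → X`. -/
def track {F : Set X} (h : C(F × I, X)) (x : F) : C(I, X) :=
  h.comp ⟨fun t => (x, t), by fun_prop⟩

/-- There is an open cover `X = F ∪ F_1 ∪ ⋯ ∪ F_k` in which each inclusion `F_j → X` is
null-homotopic and `F` can be deformed in `X`, starting from the inclusion, along curves
`γ_x` with `∫_{γ_x} ω ≤ -N`. -/
def HasCover (ω : ClosedOneForm X) (k N : ℕ) : Prop :=
  ∃ (F : Set X) (G : Fin k → Set X), IsOpen F ∧ (∀ j, IsOpen (G j)) ∧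
    F ∪ (⋃ j, G j) = Set.univ ∧
    (∀ j, (⟨Subtype.val, continuous_subtype_val⟩ : C(G j, X)).Nullhomotopic) ∧
    ∃ h : C(F × I, X), (∀ x : F, h (x, 0) = x) ∧
      ∀ x : F, ω.integral (track h x) ≤ -(N : ℝ)

/-- `cat(X, ξ)`: the least `k` such that for every integer `N > 0` a cover as above exists, where
`ω` is a continuous closed 1-form representing `ξ` (on a finite CW-complex the choice of `ω` does not
matter). The value is `⊤` if there is no such `k`. -/
def cat (ξ : H1 X) : ℕ∞ :=
  sInf {m : ℕ∞ | ∃ k : ℕ, m = k ∧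
    ∃ ω : ClosedOneForm X, ω.Represents ξ ∧ ∀ N : ℕ, 0 < N → HasCover ω k N}

end Category

section Flows

/-- `Fix(φ)`. -/
def fix (φ : Flow ℝ X) : Set X := {x | ∀ t : ℝ, φ t x = x}

/-- `φ` is a gradient-like flow of `ω`: off the fixed point set, each `f_U` strictly decreases
along every piece of trajectory contained in `U`. -/
def IsGradientLike (ω : ClosedOneForm X) (φ : Flow ℝ X) : Prop :=
  ∀ (U : ω.cover) (x : X), x ∉ fix φ → ∀ t : ℝ, 0 < t →
    (∀ s ∈ Set.Icc 0 t, φ s x ∈ U.1) → ω.val U (φ t x) < ω.val U x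

/-- The zeros of `ω`: the points fixed by every gradient-like flow of `ω`. -/
def zeros (ω : ClosedOneForm X) : Set X :=
  {p | ∀ φ : Flow ℝ X, IsGradientLike ω φ → p ∈ fix φ}

/-- `φ` has a homoclinic cycle: a cyclically ordered sequence of `n + 1 ≥ 1` non-constant
trajectories `γ_i` with `lim_{t → ∞} γ_i = p_{i+1} = lim_{t → -∞} γ_{i+1}`
(indices modulo `n + 1`). -/
def HasHomoclinicCycle (φ : Flow ℝ X) : Prop :=
  ∃ (n : ℕ) (x p : Fin (n + 1) → X), ∀ i, x i ∉ fix φ ∧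
    Filter.Tendsto (fun t : ℝ => φ t (x i)) Filter.atTop (𝓝 (p (i + 1))) ∧
    Filter.Tendsto (fun t : ℝ => φ t (x i)) Filter.atBot (𝓝 (p i))

end Flows

end LSForm

end

/-! Both parts come from one inequality: a gradient-like flow φ with finitely many fixed points and
no homoclinic cycle forces cat(X, ξ) to be at most the number of zeros
(`IsGradientLike.cat_le_encard_zeros`). Part (1) is its contrapositive.

Fix N and follow φ on states (x, a), where the budget a shrinks by the decrease of ω along the
trajectory (`budgetFlow`). A point that starts with budget N and exhausts it has been moved along a
curve with integral below -N. A state in `viable` never exhausts its budget; since ω then decreases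
only boundedly, its trajectory converges to a fixed point.

The property `CoverProperty ω N (viableTo ω φ N R) m` is carried from R = Fix(φ) down to R = ∅,
deleting one fixed point at a time. For R = Fix(φ) the states in question all exhaust their budget,
and by compactness they do so at a common time, so no contractible set is needed
(`coverProperty_viable`). For R = ∅ there is nothing to avoid, so the identity deformation gives a
cover of all of X.

Without homoclinic cycles every nonempty R contains a point p from which no trajectory leads back to
R. Such a p is stable for the states in `viableTo ω φ N R` (`exists_stable_nhds`), so compact
families of these states converging to p enter a small neighbourhood of p simultaneously. If p is a
zero, a neighbourhood that is null-homotopic in X, available since X is a finite CW-complex, absorbs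
them at the cost of one set (`coverProperty_diff_succ`). If p is not a zero, another gradient-like
flow ψ moves p and pushes the states below the level of p, where they leave `viableTo ω φ N R`; this
costs no set (`coverProperty_diff`). Hence exactly the zeros are counted. -/

noncomputable section

namespace LSForm

open Topology unitInterval Filter

universe u

/-! ### Integrals of a closed 1-form along paths and trajectories -/

section Integrals

variable {X : Type u} [TopologicalSpace X]

namespace ClosedOneForm

theorem continuousOn_val (ω : ClosedOneForm X) (U : ω.cover) :
    ContinuousOn (ω.val U) (U.1 : Set X) := by
  rw [continuousOn_iff_continuous_domRestrict]
  refine (ω.fn U).continuous.congr fun x => ?_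
  have hx : x.1 ∈ U.1 := x.2
  simp [val, hx]

theorem continuousAt_val (ω : ClosedOneForm X) (U : ω.cover) {x : X} (hx : x ∈ U.1) :
    ContinuousAt (ω.val U) x :=
  (ω.continuousOn_val U).continuousAt (U.1.isOpen.mem_nhds hx)

/-- `g` is a primitive of the pull-back of `ω` along `γ`. -/
def IsPrimitive (ω : ClosedOneForm X) (γ : C(I, X)) (g : I → ℝ) : Prop :=
  ∀ (s : I) (V : ω.cover), γ s ∈ V.1 →
    ∀ᶠ s' in 𝓝 s, g s' - g s = ω.val V (γ s') - ω.val V (γ s)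

theorem exists_isPrimitive (ω : ClosedOneForm X) (γ : C(I, X)) : ∃ g, ω.IsPrimitive γ g := by
  obtain ⟨g, -, hg⟩ := (ω.integral_spec γ).exists_primitive
  exact ⟨g, hg⟩

theorem IsPrimitive.integral_eq {ω : ClosedOneForm X} {γ : C(I, X)} {g : I → ℝ}
    (hg : ω.IsPrimitive γ g) : ω.integral γ = g 1 - g 0 := by
  obtain ⟨k, hk, hk'⟩ := (ω.integral_spec γ).exists_primitive
  have hlc : IsLocallyConstant (fun s => g s - k s) := by
    rw [IsLocallyConstant.iff_eventually_eq]
    intro s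
    obtain ⟨V, hV, hs⟩ := ω.covers (γ s)
    filter_upwards [hg s ⟨V, hV⟩ hs, hk' s ⟨V, hV⟩ hs] with s' h1 h2
    linarith
  have := hlc.apply_eq_of_isPreconnected isPreconnected_univ (Set.mem_univ 1) (Set.mem_univ 0)
  linarith

theorem IsPrimitive.comp {ω : ClosedOneForm X} {γ : C(I, X)} {g : I → ℝ}
    (hg : ω.IsPrimitive γ g) (θ : C(I, I)) : ω.IsPrimitive (γ.comp θ) (g ∘ θ) :=
  fun s V hV => (θ.continuous.tendsto s).eventually (hg (θ s) V hV)

theorem integral_const (ω : ClosedOneForm X) (x : X) :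
    ω.integral (ContinuousMap.const I x) = 0 := by
  have h : ω.IsPrimitive (ContinuousMap.const I x) (fun _ => 0) := fun s V _ => by simp
  simpa using h.integral_eq

theorem integral_of_mem (ω : ClosedOneForm X) (γ : C(I, X)) (U : ω.cover)
    (h : ∀ s, γ s ∈ U.1) : ω.integral γ = ω.val U (γ 1) - ω.val U (γ 0) := by
  have h : ω.IsPrimitive γ (fun s => ω.val U (γ s)) := fun s V hV =>
    (γ.continuous.tendsto s).eventually (ω.val_sub_eventually U V (γ s) (h s) hV)
  exact h.integral_eq

/-- The integral over a concatenation of two paths. -/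
theorem integral_concat (ω : ClosedOneForm X) (γ γ₁ γ₂ : C(I, X)) (m : I)
    (θ₁ θ₂ : C(I, I)) (h₁0 : θ₁ 0 = 0) (h₁1 : θ₁ 1 = m) (h₂0 : θ₂ 0 = m) (h₂1 : θ₂ 1 = 1)
    (h₁ : γ.comp θ₁ = γ₁) (h₂ : γ.comp θ₂ = γ₂) :
    ω.integral γ = ω.integral γ₁ + ω.integral γ₂ := by
  obtain ⟨g, hg⟩ := ω.exists_isPrimitive γ
  rw [← h₁, ← h₂, hg.integral_eq, (hg.comp θ₁).integral_eq, (hg.comp θ₂).integral_eq]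
  simp [h₁0, h₁1, h₂0, h₂1]

/-- A subdivision adapted to the path at `y₀` stays adapted for all nearby parameters, because each
subinterval is compact. Near `y₀` the integral is therefore one fixed finite sum of continuous
terms. -/
theorem continuous_integral_curry (ω : ClosedOneForm X) {Y : Type*} [TopologicalSpace Y]
    (h : C(Y × I, X)) : Continuous fun y => ω.integral (h.curry y) := by
  rw [continuous_iff_continuousAt]
  intro y₀
  obtain ⟨n, t, U, ht, h0, h1, hU, ha⟩ := ω.integral_spec (h.curry y₀)
  have hev : ∀ᶠ y in 𝓝 y₀, ∀ i ∈ Finset.range n, ∀ s ∈ Set.Icc (t i) (t (i + 1)),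
      h (y, s) ∈ (U i).1 := by
    refine (Filter.eventually_all_finset _).2 fun i hi => ?_
    refine isCompact_Icc.eventually_forall_of_forall_eventually fun s hs => ?_
    exact (h.continuous.tendsto (y₀, s)).eventually
      ((U i).1.isOpen.mem_nhds (hU i (Finset.mem_range.1 hi) s hs))
  have heq : (fun y => ∑ i ∈ Finset.range n,
      (ω.val (U i) (h (y, t (i + 1))) - ω.val (U i) (h (y, t i)))) =ᶠ[𝓝 y₀]
      fun y => ω.integral (h.curry y) := by
    filter_upwards [hev] with y hy
    exact (integral_eq (γ := h.curry y) ⟨n, t, U, ht, h0, h1, fun i hi => hy i (Finset.mem_range.2 hi), rfl⟩).symm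
  refine ContinuousAt.congr ?_ heq
  refine tendsto_finsetSum _ fun i hi => ?_
  have key : ∀ s ∈ Set.Icc (t i) (t (i + 1)),
      ContinuousAt (fun y => ω.val (U i) (h (y, s))) y₀ := fun s hs =>
    ContinuousAt.comp (f := fun y => h (y, s))
      (ω.continuousAt_val (U i) (hU i (Finset.mem_range.1 hi) s hs)) (by fun_prop)
  have hle := ht (Nat.le_succ i)
  exact (key _ ⟨hle, le_rfl⟩).sub (key _ ⟨le_rfl, hle⟩)

/-- The affine piece `u ↦ c (a + (b - a) u)` of a curve. -/
def _root_.LSForm.segment (c : C(ℝ, X)) (a b : ℝ) : C(I, X) :=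
  ⟨fun u => c (a + (b - a) * u), by fun_prop⟩

/-- The times are in no particular order. All three pieces are reparametrised parts of the single
curve on [-L, L], so a primitive there computes all of them. -/
theorem integral_segment_add (ω : ClosedOneForm X) (c : C(ℝ, X)) (a b d : ℝ) :
    ω.integral (segment c a b) + ω.integral (segment c b d) = ω.integral (segment c a d) := by
  -- The summand 1 keeps L positive when all three times vanish, so that rescaling by 2L makes
  -- sense.
  set L : ℝ := max (max |a| |b|) |d| + 1 with hL
  have hLpos : 0 < L := by positivity
  have ha : |a| ≤ L := by
    have := le_max_left |a| |b|
    have := le_max_left (max |a| |b|) |d|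
    linarith
  have hb : |b| ≤ L := by
    have := le_max_right |a| |b|
    have := le_max_left (max |a| |b|) |d|
    linarith
  have hd : |d| ≤ L := by
    have := le_max_right (max |a| |b|) |d|
    linarith
  obtain ⟨g, hg⟩ := ω.exists_isPrimitive (segment c (-L) L)
  have hmem : ∀ x : ℝ, |x| ≤ L → (x + L) / (2 * L) ∈ I := fun x hx => by
    have := abs_le.1 hx
    exact ⟨div_nonneg (by linarith) (by linarith), (div_le_one (by linarith)).2 (by linarith)⟩
  have hconv : ∀ x y : ℝ, |x| ≤ L → |y| ≤ L → ∀ u : I, |x + (y - x) * u| ≤ L := by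
    intro x y hx hy u
    have hx := abs_le.1 hx
    have hy := abs_le.1 hy
    have h0 := u.2.1
    have h1 := u.2.2
    rw [abs_le]
    constructor <;> nlinarith
  have key : ∀ x y : ℝ, ∀ (hx : |x| ≤ L) (hy : |y| ≤ L),
      ω.integral (segment c x y) = g ⟨_, hmem y hy⟩ - g ⟨_, hmem x hx⟩ := by
    intro x y hx hy
    let θ : C(I, I) := ⟨fun u => ⟨(x + (y - x) * u + L) / (2 * L), hmem _ (hconv x y hx hy u)⟩,
      Continuous.subtype_mk (by fun_prop) _⟩
    have h1 : segment c x y = (segment c (-L) L).comp θ := by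
      ext u
      simp only [segment, ContinuousMap.coe_mk, ContinuousMap.comp_apply, θ]
      congr 1
      field_simp
      ring
    rw [h1, (hg.comp θ).integral_eq]
    simp [θ]
  rw [key a b ha hb, key b d hb hd, key a d ha hd]
  ring

end ClosedOneForm

open ClosedOneForm

/-- The trajectory of `x` as a continuous curve. -/
def orbitCurve (φ : Flow ℝ X) (x : X) : C(ℝ, X) :=
  ⟨fun t => φ t x, φ.continuous continuous_id continuous_const⟩

/-- The integral of `ω` along the trajectory of `x` from time `0` to time `t`. -/
def drop (ω : ClosedOneForm X) (φ : Flow ℝ X) (x : X) (t : ℝ) : ℝ :=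
  ω.integral (segment (orbitCurve φ x) 0 t)

theorem continuous_drop (ω : ClosedOneForm X) (φ : Flow ℝ X) :
    Continuous fun z : X × ℝ => drop ω φ z.1 z.2 := by
  let h : C((X × ℝ) × I, X) := ⟨fun z => φ (0 + (z.1.2 - 0) * z.2) z.1.1,
    φ.continuous (by fun_prop) (by fun_prop)⟩
  exact ω.continuous_integral_curry h

theorem drop_add (ω : ClosedOneForm X) (φ : Flow ℝ X) (x : X) (s t : ℝ) :
    drop ω φ x (s + t) = drop ω φ x s + drop ω φ (φ s x) t := by
  have h : segment (orbitCurve φ (φ s x)) 0 t = segment (orbitCurve φ x) s (s + t) := by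
    ext u
    simp only [segment, orbitCurve, ContinuousMap.coe_mk]
    rw [← φ.map_add]
    congr 1
    ring
  rw [drop, drop, drop, h, integral_segment_add]

theorem drop_zero (ω : ClosedOneForm X) (φ : Flow ℝ X) (x : X) : drop ω φ x 0 = 0 := by
  have := drop_add ω φ x 0 0
  simp only [add_zero, Flow.map_zero_apply] at this
  linarith

theorem drop_fix (ω : ClosedOneForm X) (φ : Flow ℝ X) {x : X} (hx : x ∈ fix φ) (t : ℝ) :
    drop ω φ x t = 0 := by
  have : segment (orbitCurve φ x) 0 t = ContinuousMap.const I x := by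
    ext u
    exact hx _
  rw [drop, this, integral_const]

theorem fix_flow_iff (φ : Flow ℝ X) (x : X) (s : ℝ) : φ s x ∈ fix φ ↔ x ∈ fix φ := by
  have key : ∀ (y : X) (r : ℝ), y ∈ fix φ → φ r y ∈ fix φ := fun y r h t => by
    rw [h r, h t]
  refine ⟨fun h => ?_, key x s⟩
  have := key _ (-s) h
  rwa [← φ.map_add, neg_add_cancel, φ.map_zero_apply] at this

theorem drop_of_mem (ω : ClosedOneForm X) (φ : Flow ℝ X) (U : ω.cover) {x : X} {t : ℝ}
    (ht : 0 ≤ t) (h : ∀ s ∈ Set.Icc 0 t, φ s x ∈ U.1) :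
    drop ω φ x t = ω.val U (φ t x) - ω.val U x := by
  rw [drop, ω.integral_of_mem _ U]
  · simp [segment, orbitCurve]
  · intro s
    exact h _ ⟨by have := s.2.1; simp; positivity,
      by have := s.2.1; have := s.2.2; simp; nlinarith⟩

/-- The gradient-like condition only speaks of pieces inside one member of the cover. Along an
adapted subdivision every nondegenerate piece contributes a negative term, and a subdivision from 0
to 1 has such a piece. -/
theorem IsGradientLike.drop_neg {ω : ClosedOneForm X} {φ : Flow ℝ X} (hφ : IsGradientLike ω φ)
    {x : X} (hx : x ∉ fix φ) {t : ℝ} (ht : 0 < t) : drop ω φ x t < 0 := by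
  obtain ⟨n, r, U, hr, h0, h1, hU, ha⟩ := ω.integral_spec (segment (orbitCurve φ x) 0 t)
  rw [drop, ha]
  have heq : ∀ s : I, segment (orbitCurve φ x) 0 t s = φ (t * s) x := fun s => by
    simp [segment, orbitCurve]
  have key : ∀ i < n, r i < r (i + 1) →
      ω.val (U i) (segment (orbitCurve φ x) 0 t (r (i + 1))) -
        ω.val (U i) (segment (orbitCurve φ x) 0 t (r i)) < 0 := by
    intro i hi hlt
    have hlt' : (r i : ℝ) < r (i + 1) := hlt
    rw [heq, heq, sub_neg]
    have := hφ (U i) (φ (t * r i) x) (by rwa [fix_flow_iff]) (t * (r (i + 1) - r i))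
      (mul_pos ht (by linarith)) ?_
    · rw [← φ.map_add] at this
      convert this using 3
      ring
    · intro s hs
      rw [← φ.map_add]
      have h2 : s / t + r i ∈ Set.Icc (r i : ℝ) (r (i + 1)) := by
        have e1 : 0 ≤ s / t := div_nonneg hs.1 ht.le
        have e2 : s / t ≤ r (i + 1) - r i := by
          rw [div_le_iff₀ ht]
          linarith [hs.2]
        constructor <;> linarith
      have h3 : s / t + r i ∈ I := ⟨(r i).2.1.trans h2.1, h2.2.trans (r (i + 1)).2.2⟩
      have := hU i hi ⟨_, h3⟩ ⟨h2.1, h2.2⟩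
      rw [heq] at this
      convert this using 2
      field_simp
  have hex : ∃ i ∈ Finset.range n, r i < r (i + 1) := by
    by_contra hcon
    push Not at hcon
    have : ∀ i ≤ n, r i = 0 := by
      intro i
      induction i with
      | zero => exact fun _ => h0
      | succ i ih =>
        intro hi
        exact le_antisymm ((hcon i (Finset.mem_range.2 hi)).trans (ih (by lia)).le) (r (i+1)).2.1
    have := this n le_rfl
    rw [h1] at this
    exact one_ne_zero this
  refine lt_of_lt_of_eq (Finset.sum_lt_sum (g := fun _ => (0 : ℝ)) ?_ ?_) (by simp)
  · intro i hi
    rcases (hr (Nat.le_succ i)).lt_or_eq with h | h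
    · exact (key i (Finset.mem_range.1 hi) h).le
    · simp only [Nat.succ_eq_add_one] at h
      rw [h, sub_self]
  · obtain ⟨i, hi, h⟩ := hex
    exact ⟨i, hi, key i (Finset.mem_range.1 hi) h⟩

theorem IsGradientLike.drop_nonpos {ω : ClosedOneForm X} {φ : Flow ℝ X} (hφ : IsGradientLike ω φ)
    (x : X) {t : ℝ} (ht : 0 ≤ t) : drop ω φ x t ≤ 0 := by
  by_cases hx : x ∈ fix φ
  · exact (drop_fix ω φ hx t).le
  · rcases ht.eq_or_lt with rfl | h
    · exact (drop_zero ω φ x).le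
    · exact (hφ.drop_neg hx h).le

theorem IsGradientLike.drop_antitone {ω : ClosedOneForm X} {φ : Flow ℝ X}
    (hφ : IsGradientLike ω φ) (x : X) : Antitone (drop ω φ x) := by
  intro s t hst
  have := drop_add ω φ x s (t - s)
  rw [add_sub_cancel] at this
  linarith [hφ.drop_nonpos (φ s x) (sub_nonneg.2 hst)]

end Integrals

/-! ### Limits of trajectories and the ordering of fixed points -/

section LimitSets

section TopologicalDynamics

theorem isOpen_forall_mem_compact {S Y Z : Type*} [TopologicalSpace S] [TopologicalSpace Y]
    [TopologicalSpace Z] {f : S → Y → Z} (hf : Continuous fun q : S × Y => f q.1 q.2)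
    {K : Set S} (hK : IsCompact K) {O : Set Z} (hO : IsOpen O) :
    IsOpen {y | ∀ s ∈ K, f s y ∈ O} := by
  rw [isOpen_iff_mem_nhds]
  intro y hy
  refine hK.eventually_forall_of_forall_eventually fun s hs => ?_
  have h : Continuous fun q : Y × S => f q.2 q.1 := hf.comp continuous_swap
  exact (h.tendsto (y, s)).eventually (hO.mem_nhds (hy s hs))

/-- If no point of the closed set `Z` has its whole backward orbit in the compact set `B`, then
orbit pieces in `B` that start close enough to an invariant set disjoint from `Z` do not
end in `Z`. -/
theorem exists_open_forall_notMem {Y : Type*} [TopologicalSpace Y] [T2Space Y] (Φ : Flow ℝ Y)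
    {B Z O P : Set Y} (hB : IsCompact B) (hZ : IsClosed Z) (hO : IsOpen O) (hPO : P ⊆ O)
    (hP : ∀ t, ∀ y ∈ P, Φ t y ∈ P) (hZO : Disjoint Z O)
    (hno : ∀ z ∈ Z, ¬ ∀ s : ℝ, 0 ≤ s → Φ (-s) z ∈ B) :
    ∃ V, IsOpen V ∧ P ⊆ V ∧ ∀ y ∈ V, ∀ r : ℝ, 0 ≤ r →
      (∀ s ∈ Set.Icc 0 r, Φ s y ∈ B) → Φ r y ∉ Z := by
  -- `E n` consists of the points of Z whose backward orbit stays in B up to time n. These sets are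
  -- compact and nested, and a common point would violate `hno`; hence some `E n` is empty.
  let E : ℕ → Set Y := fun n => Z ∩ ⋂ s ∈ Set.Icc (0 : ℝ) n, (fun z => Φ (-s) z) ⁻¹' B
  have hmemE : ∀ n z, z ∈ E n ↔ z ∈ Z ∧ ∀ s ∈ Set.Icc (0 : ℝ) n, Φ (-s) z ∈ B := by
    intro n z
    simp [E]
  have hEcl : ∀ n, IsClosed (E n) := fun n => hZ.inter <| isClosed_biInter fun s _ =>
    hB.isClosed.preimage (Φ.continuous continuous_const continuous_id)
  have hEB : ∀ n, E n ⊆ B := fun n z hz => by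
    have := ((hmemE n z).1 hz).2 0 ⟨le_rfl, n.cast_nonneg⟩
    simpa using this
  have hex : ∃ n, E n = ∅ := by
    by_contra hcon
    push Not at hcon
    obtain ⟨z, hz⟩ := IsCompact.nonempty_iInter_of_sequence_nonempty_isCompact_isClosed E
      (fun n z hz => by
        rw [hmemE] at hz ⊢
        exact ⟨hz.1, fun s hs => hz.2 s ⟨hs.1, hs.2.trans (by simp)⟩⟩)
      hcon (hB.of_isClosed_subset (hEcl 0) (hEB 0)) hEcl
    rw [Set.mem_iInter] at hz
    refine hno z ((hmemE 0 z).1 (hz 0)).1 fun s hs => ?_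
    obtain ⟨n, hn⟩ := exists_nat_ge s
    exact ((hmemE n z).1 (hz n)).2 s ⟨hs, hn⟩
  obtain ⟨n, hn⟩ := hex
  -- Starting points that remain in O up to time n can only reach Z later, and an orbit piece in B
  -- of length at least n ending in Z would end in the empty set `E n`.
  refine ⟨{y | ∀ s ∈ Set.Icc (0 : ℝ) n, Φ s y ∈ O},
    isOpen_forall_mem_compact Φ.cont' isCompact_Icc hO,
    fun y hy s _ => hPO (hP s y hy), fun y hy r hr hB' hZ' => ?_⟩
  have hnr : (n : ℝ) < r := by
    by_contra hcon
    exact Set.disjoint_left.1 hZO hZ' (hy r ⟨hr, not_lt.1 hcon⟩)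
  have : Φ r y ∈ E n := by
    rw [hmemE]
    refine ⟨hZ', fun s hs => ?_⟩
    rw [← Φ.map_add]
    exact hB' _ ⟨by linarith [hs.2], by linarith [hs.1]⟩
  rw [hn] at this
  exact this

/-- The first exit from an open set. -/
theorem exists_first_exit {Y : Type*} [TopologicalSpace Y] {c : ℝ → Y} (hc : Continuous c)
    {O V : Set Y} (hO : IsOpen O) (hV : IsClosed V) (hOV : O ⊆ V) (h0 : c 0 ∈ O) {t : ℝ}
    (ht : 0 ≤ t) (hct : c t ∉ O) :
    ∃ r ∈ Set.Icc 0 t, c r ∉ O ∧ ∀ s ∈ Set.Icc 0 r, c s ∈ V := by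
  let S : Set ℝ := Set.Icc 0 t ∩ c ⁻¹' Oᶜ
  have hS : IsCompact S := isCompact_Icc.inter_right (hO.isClosed_compl.preimage hc)
  obtain ⟨r, hr, hmin⟩ := hS.exists_isLeast ⟨t, ⟨ht, le_rfl⟩, hct⟩
  have hlt : ∀ s ∈ Set.Ico 0 r, c s ∈ V := by
    intro s hs
    by_contra hcon
    have := hmin (show s ∈ S from ⟨⟨hs.1, hs.2.le.trans hr.1.2⟩, fun h => hcon (hOV h)⟩)
    exact absurd hs.2 (not_lt.2 this)
  have hr0 : (0 : ℝ) ≠ r := by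
    rintro rfl
    exact hr.2 h0
  refine ⟨r, hr.1, hr.2, fun s hs => ?_⟩
  have hcl : IsClosed (c ⁻¹' V) := hV.preimage hc
  have := hcl.closure_subset_iff.2 (show Set.Ico 0 r ⊆ c ⁻¹' V from hlt)
  rw [closure_Ico hr0] at this
  exact this hs

/-- By compactness the curve eventually lies in a union of disjoint neighbourhoods of the points of
P. The tail is connected, so it stays in one of them, which leaves a single cluster point. -/
theorem tendsto_atTop_of_finite_clusterPts {Y : Type*} [TopologicalSpace Y] [T2Space Y]
    [CompactSpace Y] {c : ℝ → Y} (hc : Continuous c) {P : Set Y} (hP : P.Finite)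
    (h : ∀ y, MapClusterPt y atTop c → y ∈ P) : ∃ p ∈ P, Tendsto c atTop (𝓝 p) := by
  obtain ⟨U, hU, hdisj⟩ := hP.t2_separation
  have hopen : IsOpen (⋃ p ∈ P, U p) := isOpen_biUnion fun p _ => (hU p).2
  have hev : ∀ᶠ t in atTop, c t ∈ ⋃ p ∈ P, U p := by
    by_contra hcon
    rw [not_eventually] at hcon
    obtain ⟨y, hy, hy'⟩ := hopen.isClosed_compl.isCompact.exists_mapClusterPt_of_frequently hcon
    exact hy (Set.mem_biUnion (h y hy') (hU y).1)
  obtain ⟨T, hT⟩ := eventually_atTop.1 hev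
  obtain ⟨p, hp, hTp⟩ := Set.mem_iUnion₂.1 (hT T le_rfl)
  have hin : ∀ t ≥ T, c t ∈ U p := by
    have hpre : IsPreconnected (c '' Set.Ici T) := isPreconnected_Ici.image c hc.continuousOn
    have hsub : c '' Set.Ici T ⊆ U p := by
      refine hpre.subset_left_of_subset_union (v := ⋃ q ∈ P \ {p}, U q) (hU p).2
        (isOpen_biUnion fun q _ => (hU q).2) ?_ ?_ ⟨c T, ⟨T, Set.self_mem_Ici, rfl⟩, hTp⟩
      · rw [Set.disjoint_iUnion₂_right]
        exact fun q hq => hdisj hp hq.1 (fun e => hq.2 e.symm)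
      · rintro _ ⟨t, ht, rfl⟩
        obtain ⟨q, hq, htq⟩ := Set.mem_iUnion₂.1 (hT t ht)
        by_cases hqp : q = p
        · exact Or.inl (hqp ▸ htq)
        · exact Or.inr (Set.mem_biUnion (show q ∈ P \ {p} from ⟨hq, hqp⟩) htq)
    exact fun t ht => hsub ⟨t, ht, rfl⟩
  refine ⟨p, hp, isCompact_univ.tendsto_nhds_of_unique_mapClusterPt
    (Eventually.of_forall fun _ => Set.mem_univ _) fun y _ hy => ?_⟩
  by_contra hne
  have h1 : ∃ᶠ t in atTop, c t ∈ U y := mapClusterPt_iff_frequently.1 hy _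
    ((hU y).2.mem_nhds (hU y).1)
  obtain ⟨t, ht1, ht2⟩ := (h1.and_eventually (eventually_ge_atTop T)).exists
  exact Set.disjoint_left.1 (hdisj (h y hy) hp hne) ht1 (hin t ht2)

end TopologicalDynamics

variable {X : Type u} [TopologicalSpace X]

section Limits

variable {ω : ClosedOneForm X} {φ : Flow ℝ X}

theorem continuous_drop_left (ω : ClosedOneForm X) (φ : Flow ℝ X) (t : ℝ) :
    Continuous fun x : X => drop ω φ x t :=
  (continuous_drop ω φ).comp (continuous_id.prodMk (continuous_const (y := t)))

/-- At a non-fixed point the unit-time decrease is strictly negative, and by continuity it stays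
away from 0 nearby. -/
theorem IsGradientLike.mem_fix_of_mapClusterPt (hφ : IsGradientLike ω φ) {l : Filter ℝ}
    {c : ℝ → X} (h : Tendsto (fun t => drop ω φ (c t) 1) l (𝓝 0)) {y : X}
    (hy : MapClusterPt y l c) : y ∈ fix φ := by
  by_contra hcon
  have h2 : MapClusterPt (drop ω φ y 1) l ((fun x => drop ω φ x 1) ∘ c) :=
    MapClusterPt.continuousAt_comp (f := fun x => drop ω φ x 1)
      (continuous_drop_left ω φ 1).continuousAt hy
  have h3 := hφ.drop_neg hcon one_pos
  have h4 : Set.Iio (drop ω φ y 1 / 2) ∈ 𝓝 (drop ω φ y 1) := Iio_mem_nhds (by linarith)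
  have h5 : Set.Ioi (drop ω φ y 1 / 2) ∈ 𝓝 (0 : ℝ) := Ioi_mem_nhds (by linarith)
  obtain ⟨t, ht1, ht2⟩ := ((mapClusterPt_iff_frequently.1 h2 _ h4).and_eventually (h h5)).exists
  exact lt_asymm (Set.mem_Iio.1 ht1) (Set.mem_Ioi.1 ht2)

variable [T2Space X] [CompactSpace X]

/-- A bounded monotone `drop` converges, so its unit-time increments tend to 0 and every cluster
point is fixed. -/
theorem IsGradientLike.exists_tendsto_atTop (hφ : IsGradientLike ω φ) (hfin : (fix φ).Finite)
    {x : X} {b : ℝ} (hb : ∀ t, b ≤ drop ω φ x t) :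
    ∃ p ∈ fix φ, Tendsto (fun t => φ t x) atTop (𝓝 p) := by
  refine tendsto_atTop_of_finite_clusterPts (φ.continuous continuous_id continuous_const) hfin
    fun y hy => hφ.mem_fix_of_mapClusterPt ?_ hy
  have h1 := tendsto_atTop_ciInf (hφ.drop_antitone x) ⟨b, by rintro _ ⟨t, rfl⟩; exact hb t⟩
  have h2 := (h1.comp (tendsto_atTop_add_const_right _ (1 : ℝ) tendsto_id)).sub h1
  rw [sub_self] at h2
  refine h2.congr fun t => ?_
  simp [drop_add]

theorem IsGradientLike.exists_tendsto_atBot (hφ : IsGradientLike ω φ) (hfin : (fix φ).Finite)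
    {x : X} {b : ℝ} (hb : ∀ t, drop ω φ x t ≤ b) :
    ∃ p ∈ fix φ, Tendsto (fun t => φ t x) atBot (𝓝 p) := by
  have hkey : ∃ p ∈ fix φ, Tendsto (fun t : ℝ => φ (-t) x) atTop (𝓝 p) := by
    refine tendsto_atTop_of_finite_clusterPts (φ.continuous continuous_neg continuous_const) hfin
      fun y hy => hφ.mem_fix_of_mapClusterPt ?_ hy
    have h1 := (tendsto_atBot_ciSup (hφ.drop_antitone x)
      ⟨b, by rintro _ ⟨t, rfl⟩; exact hb t⟩).comp tendsto_neg_atTop_atBot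
    have h2 := (h1.comp (tendsto_atTop_add_const_right _ (-1 : ℝ) tendsto_id)).sub h1
    rw [sub_self] at h2
    refine h2.congr fun t => ?_
    have := drop_add ω φ x (-t) 1
    have e : -(t + -1) = -t + 1 := by ring
    simp only [Function.comp, id, e]
    linarith
  obtain ⟨p, hp, h⟩ := hkey
  refine ⟨p, hp, (h.comp tendsto_neg_atBot_atTop).congr fun t => ?_⟩
  simp

end Limits

theorem exists_isolating_nhds [T2Space X] [CompactSpace X] {P : Set X} (hP : P.Finite) (p : X)
    {V : Set X} (hV : V ∈ 𝓝 p) :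
    ∃ V₀ ∈ 𝓝 p, IsClosed V₀ ∧ V₀ ⊆ V ∧ ∀ q ∈ P, q ∈ V₀ → q = p := by
  have h : V ∩ (P \ {p})ᶜ ∈ 𝓝 p :=
    inter_mem hV ((hP.sdiff).isClosed.isOpen_compl.mem_nhds (by simp))
  obtain ⟨V₀, h1, h2, h3⟩ := exists_mem_nhds_isClosed_subset h
  refine ⟨V₀, h1, h2, fun x hx => (h3 hx).1, fun q hq hqV => ?_⟩
  by_contra hne
  exact (h3 hqV).2 ⟨hq, hne⟩

/-- Without homoclinic cycles, every finite nonempty set of fixed points has a member from which no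
trajectory leads back to the set. -/
theorem exists_minimal_of_not_hasHomoclinicCycle {φ : Flow ℝ X} (hno : ¬ HasHomoclinicCycle φ)
    {R : Set X} (hR : R.Finite) (hne : R.Nonempty) :
    ∃ p ∈ R, ∀ y ∉ fix φ, ∀ q ∈ R, Tendsto (fun t => φ t y) atBot (𝓝 p) →
      ¬ Tendsto (fun t => φ t y) atTop (𝓝 q) := by
  by_contra hcon
  push Not at hcon
  choose! y hy q hq hbot htop using hcon
  have := hR.to_subtype
  -- If the claim fails, every point of R has a trajectory leading to a successor in R. The
  -- successor map on a finite set has a periodic orbit, which is a homoclinic cycle.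
  let s : R → R := fun p => ⟨q p, hq p p.2⟩
  obtain ⟨p₀, hp₀⟩ := hne
  obtain ⟨p, m, hm, hper⟩ : ∃ p : R, ∃ m, 0 < m ∧ s^[m] p = p := by
    obtain ⟨a, b, hab, he⟩ :=
      Finite.exists_ne_map_eq_of_infinite (fun n : ℕ => s^[n] ⟨p₀, hp₀⟩)
    wlog hlt : a < b generalizing a b
    · exact this b a hab.symm he.symm (lt_of_le_of_ne (not_lt.1 hlt) hab.symm)
    refine ⟨s^[a] ⟨p₀, hp₀⟩, b - a, Nat.sub_pos_of_lt hlt, ?_⟩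
    rw [← Function.iterate_add_apply, Nat.sub_add_cancel hlt.le]
    exact he.symm
  obtain ⟨n, rfl⟩ := Nat.exists_eq_add_of_lt hm
  rw [zero_add] at hper
  refine hno ⟨n, fun i => y (s^[i] p), fun i => (s^[i] p : R), fun i => ⟨hy _ (s^[i] p).2, ?_,
    hbot _ (s^[i] p).2⟩⟩
  -- The addition in `Fin (n + 1)` wraps around, which is harmless since p has period n + 1.
  have h1 : s^[((i + 1 : Fin (n + 1)) : ℕ)] p = s (s^[i] p) := by
    rw [← Function.iterate_succ_apply' s, Fin.val_add, Fin.val_one', Nat.add_mod_mod]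
    exact (show Function.IsPeriodicPt s (n + 1) p from hper).iterate_mod_apply _
  change Tendsto _ _ (𝓝 (s^[((i + 1 : Fin (n + 1)) : ℕ)] p : X))
  rw [h1]
  exact htop _ (s^[i] p).2

end LimitSets

/-! ### States with a budget, and stability of minimal fixed points -/

section Budget

variable {X : Type u} [TopologicalSpace X]

/-- The flow on `X × ℝ` whose second coordinate keeps track of the integral of `ω` along the
trajectories of `φ`. -/
def budgetFlow (ω : ClosedOneForm X) (φ : Flow ℝ X) : Flow ℝ (X × ℝ) where
  toFun t z := (φ t z.1, z.2 + drop ω φ z.1 t)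
  cont' := by
    refine (φ.continuous continuous_fst (continuous_fst.comp continuous_snd)).prodMk
      ((continuous_snd.comp continuous_snd).add ?_)
    exact (continuous_drop ω φ).comp ((continuous_fst.comp continuous_snd).prodMk continuous_fst)
  map_add' s t z := by
    rw [φ.map_add, add_comm s t, drop_add, add_assoc]
  map_zero' z := by
    rw [φ.map_zero_apply, drop_zero, add_zero]

/-- The states `(x, a)` with `a ≤ N` whose budget `a` is never exceeded by the decrease of `ω` along
the forward trajectory of `x`. -/
def viable (ω : ClosedOneForm X) (φ : Flow ℝ X) (N : ℝ) : Set (X × ℝ) :=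
  {z | z.2 ≤ N ∧ ∀ t : ℝ, 0 ≤ t → 0 ≤ z.2 + drop ω φ z.1 t}

/-- The states in `viable ω φ N` whose trajectory converges to a point of `R`. -/
def viableTo (ω : ClosedOneForm X) (φ : Flow ℝ X) (N : ℝ) (R : Set X) : Set (X × ℝ) :=
  {z | z ∈ viable ω φ N ∧ ∃ p ∈ R, Tendsto (fun t => φ t z.1) atTop (𝓝 p)}

variable {ω : ClosedOneForm X} {φ : Flow ℝ X} {N : ℝ} {R : Set X}

theorem isClosed_viable : IsClosed (viable ω φ N) := by
  have h : viable ω φ N = {z | z.2 ≤ N} ∩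
      ⋂ t ∈ Set.Ici (0 : ℝ), {z : X × ℝ | 0 ≤ z.2 + drop ω φ z.1 t} := by
    ext z
    simp [viable]
  rw [h]
  exact (isClosed_le continuous_snd continuous_const).inter <| isClosed_biInter fun t _ =>
    isClosed_le continuous_const
      (continuous_snd.add ((continuous_drop_left ω φ t).comp continuous_fst))

theorem viable_subset : viable ω φ N ⊆ Set.univ ×ˢ Set.Icc 0 N := by
  rintro z ⟨h1, h2⟩
  have := h2 0 le_rfl
  rw [drop_zero, add_zero] at this
  exact ⟨trivial, this, h1⟩

theorem isCompact_viableTo [CompactSpace X] (hcl : IsClosed (viableTo ω φ N R)) :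
    IsCompact (viableTo ω φ N R) :=
  (isCompact_univ.prod isCompact_Icc).of_isClosed_subset hcl fun _ hz => viable_subset hz.1

theorem tendsto_flow_iff (φ : Flow ℝ X) (x p : X) (s : ℝ) :
    Tendsto (fun t => φ t (φ s x)) atTop (𝓝 p) ↔ Tendsto (fun t => φ t x) atTop (𝓝 p) := by
  have key : ∀ (y : X) (r : ℝ), Tendsto (fun t => φ t y) atTop (𝓝 p) →
      Tendsto (fun t => φ t (φ r y)) atTop (𝓝 p) := fun y r h => by
    refine (h.comp (tendsto_atTop_add_const_right atTop r tendsto_id)).congr fun t => ?_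
    simp [φ.map_add]
  refine ⟨fun h => ?_, key x s⟩
  have := key _ (-s) h
  simpa only [← φ.map_add s, ← φ.map_add (-s), neg_add_cancel, φ.map_zero_apply] using this

theorem IsGradientLike.budgetFlow_mem (hφ : IsGradientLike ω φ) {z : X × ℝ}
    (hz : z ∈ viableTo ω φ N R) {t : ℝ} (ht : 0 ≤ t) : budgetFlow ω φ t z ∈ viableTo ω φ N R := by
  obtain ⟨⟨h1, h2⟩, p, hp, h3⟩ := hz
  refine ⟨⟨?_, fun s hs => ?_⟩, p, hp, (tendsto_flow_iff φ _ p t).2 h3⟩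
  · have := hφ.drop_nonpos z.1 ht
    change z.2 + drop ω φ z.1 t ≤ N
    linarith
  · have := h2 (t + s) (by positivity)
    rw [drop_add] at this
    change 0 ≤ z.2 + drop ω φ z.1 t + drop ω φ (φ t z.1) s
    linarith

/-- Going back in time only raises the budget, so the bound N is the one condition that could fail.
Read contrapositively, flowing forward by φ never brings a state into `viableTo ω φ N R`. -/
theorem IsGradientLike.mem_of_budgetFlow_mem (hφ : IsGradientLike ω φ) {z : X × ℝ} {t : ℝ}
    (ht : 0 ≤ t) (hz : budgetFlow ω φ t z ∈ viableTo ω φ N R) (hN : z.2 ≤ N) :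
    z ∈ viableTo ω φ N R := by
  obtain ⟨⟨h1, h2⟩, p, hp, h3⟩ := hz
  refine ⟨⟨hN, fun s hs => ?_⟩, p, hp, (tendsto_flow_iff φ _ p t).1 h3⟩
  have h4 : 0 ≤ z.2 + drop ω φ z.1 t + drop ω φ (φ t z.1) s := h2 s hs
  have h5 := hφ.drop_antitone z.1 (show s ≤ t + s by linarith)
  rw [drop_add] at h5
  linarith

variable [T2Space X] [CompactSpace X]

/-- A finite budget bounds the total decrease of ω, which forces convergence to a fixed point. -/
theorem IsGradientLike.viableTo_fix (hφ : IsGradientLike ω φ) (hfin : (fix φ).Finite) :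
    viableTo ω φ N (fix φ) = viable ω φ N := by
  refine Set.Subset.antisymm (fun z hz => hz.1) fun z hz => ⟨hz, ?_⟩
  refine hφ.exists_tendsto_atTop hfin (b := -z.2) fun t => ?_
  have h1 := hφ.drop_antitone z.1 (le_max_left t 0)
  have h2 := hz.2 (max t 0) (le_max_right _ _)
  linarith

/-- A fixed point from which no trajectory leads back to `R` is stable relative to
`viableTo ω φ N R`. -/
theorem IsGradientLike.exists_stable_nhds (hφ : IsGradientLike ω φ) (hfin : (fix φ).Finite)
    (hcl : IsClosed (viableTo ω φ N R)) {p : X} (hp : p ∈ fix φ)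
    (hmin : ∀ y ∉ fix φ, ∀ q ∈ R, Tendsto (fun t => φ t y) atBot (𝓝 p) →
      ¬ Tendsto (fun t => φ t y) atTop (𝓝 q)) {V : Set X} (hV : V ∈ 𝓝 p) :
    ∃ V', IsOpen V' ∧ p ∈ V' ∧ ∀ z ∈ viableTo ω φ N R, z.1 ∈ V' → ∀ t : ℝ, 0 ≤ t →
      φ t z.1 ∈ V := by
  obtain ⟨V₀, hV₀, hV₀c, hV₀V, hiso⟩ := exists_isolating_nhds hfin p hV
  have hpV₀ : p ∈ interior V₀ := mem_interior_iff_mem_nhds.2 hV₀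
  let B : Set (X × ℝ) := viableTo ω φ N R ∩ Prod.fst ⁻¹' V₀
  have hB : IsCompact B := (isCompact_viableTo hcl).inter_right (hV₀c.preimage continuous_fst)
  let O : Set (X × ℝ) := Prod.fst ⁻¹' interior V₀
  have hO : IsOpen O := isOpen_interior.preimage continuous_fst
  -- The set {p} × [0, N] consists of fixed points of the budget flow. Orbit pieces starting near it
  -- should not reach the complement of the interior of V₀ while staying in B.
  obtain ⟨W, hWo, hW, hexit⟩ := exists_open_forall_notMem (budgetFlow ω φ) (B := B) (Z := Oᶜ)
    (O := O) (P := {p} ×ˢ Set.Icc 0 N) hB hO.isClosed_compl hO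
    (fun z hz => by rw [Set.mem_preimage, hz.1]; exact hpV₀)
    (fun t z hz => by
      have h1 : z.1 = p := hz.1
      refine ⟨?_, ?_⟩
      · change φ t z.1 = p
        rw [h1, hp t]
      · change z.2 + drop ω φ z.1 t ∈ _
        rw [h1, drop_fix ω φ hp, add_zero]
        exact hz.2)
    disjoint_compl_left
    (by
      -- The budget along the backward orbit never exceeds N, so the orbit has a backward limit.
      -- That limit is a fixed point in V₀, hence p, and the trajectory would lead from p to R.
      intro z hz hback
      have hzB := hback 0 le_rfl
      rw [neg_zero, Flow.map_zero_apply] at hzB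
      have hnf : z.1 ∉ fix φ := fun hf => hz (by
        rw [Set.mem_preimage, hiso _ hf hzB.2]
        exact hpV₀)
      have hzN : z.2 ≤ N := hzB.1.1.1
      obtain ⟨p', hp', hlim⟩ := hφ.exists_tendsto_atBot hfin (x := z.1) (b := N - z.2) (by
        intro t
        rcases le_total 0 t with ht | ht
        · linarith [hφ.drop_nonpos z.1 ht]
        · have h1 : z.2 + drop ω φ z.1 (- -t) ≤ N := (hback (-t) (by linarith)).1.1.1
          rw [neg_neg] at h1
          linarith)
      have hp'V : p' ∈ V₀ := by
        refine hV₀c.mem_of_tendsto hlim ?_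
        filter_upwards [eventually_le_atBot 0] with t ht
        have h1 : φ (- -t) z.1 ∈ V₀ := (hback (-t) (by linarith)).2
        rwa [neg_neg] at h1
      obtain ⟨q, hq, hlim'⟩ := hzB.1.2
      rw [hiso p' hp' hp'V] at hlim
      exact hmin z.1 hnf q hq hlim hlim')
  -- Compactness of [0, N] makes the neighbourhood of p independent of the budget.
  obtain ⟨V₁, W₁, hV₁, -, hpV₁, hW₁, hsub⟩ :=
    generalized_tube_lemma isCompact_singleton isCompact_Icc hWo hW
  refine ⟨V₁ ∩ interior V₀, hV₁.inter isOpen_interior, ⟨hpV₁ rfl, hpV₀⟩, fun z hz hzV t ht => ?_⟩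
  by_contra hcon
  obtain ⟨r, hr, hr1, hr2⟩ := exists_first_exit (c := fun t => φ t z.1)
    (φ.continuous continuous_id continuous_const) isOpen_interior hV₀c interior_subset
    (by simpa using hzV.2) ht (fun h => hcon (hV₀V (interior_subset h)))
  refine hexit z (hsub ⟨hzV.1, hW₁ (viable_subset hz.1).2⟩) r hr.1 (fun s hs => ?_) hr1
  exact ⟨hφ.budgetFlow_mem hz hs.1, hr2 s hs⟩

/-- Compact sets of states converging to a stable fixed point enter its neighbourhoods
simultaneously. -/
theorem IsGradientLike.exists_forall_mem_nhds (hφ : IsGradientLike ω φ) (hfin : (fix φ).Finite)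
    (hcl : IsClosed (viableTo ω φ N R)) {p : X} (hp : p ∈ fix φ)
    (hmin : ∀ y ∉ fix φ, ∀ q ∈ R, Tendsto (fun t => φ t y) atBot (𝓝 p) →
      ¬ Tendsto (fun t => φ t y) atTop (𝓝 q)) {V : Set X} (hV : V ∈ 𝓝 p) {M : Set (X × ℝ)}
    (hM : IsCompact M) (hMR : M ⊆ viableTo ω φ N R)
    (hMp : ∀ z ∈ M, Tendsto (fun t => φ t z.1) atTop (𝓝 p)) :
    ∃ T : ℝ, 0 ≤ T ∧ ∀ z ∈ M, φ T z.1 ∈ V := by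
  obtain ⟨V', hV'o, hpV', hV'⟩ := hφ.exists_stable_nhds hfin hcl hp hmin hV
  -- Asking for all later times lets finitely many local times be replaced by their maximum; the
  -- stable neighbourhood V' provides this.
  suffices h : ∃ T : ℝ, 0 ≤ T ∧ ∀ z ∈ M, ∀ t ≥ T, φ t z.1 ∈ V by
    obtain ⟨T, hT, h⟩ := h
    exact ⟨T, hT, fun z hz => h z hz T le_rfl⟩
  suffices h : ∃ T : ℝ, 0 ≤ T ∧ ∀ z ∈ M, z ∈ M → ∀ t ≥ T, φ t z.1 ∈ V by
    obtain ⟨T, hT, h⟩ := h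
    exact ⟨T, hT, fun z hz => h z hz hz⟩
  refine hM.induction_on (p := fun M' => ∃ T : ℝ, 0 ≤ T ∧ ∀ z ∈ M', z ∈ M → ∀ t ≥ T, φ t z.1 ∈ V)
    ⟨0, le_rfl, by simp⟩ ?_ ?_ ?_
  · rintro s t hst ⟨T, hT, h⟩
    exact ⟨T, hT, fun z hz => h z (hst hz)⟩
  · rintro s t ⟨T, hT, h⟩ ⟨T', hT', h'⟩
    refine ⟨max T T', le_max_of_le_left hT, ?_⟩
    rintro z (hz | hz) hzM r hr
    · exact h z hz hzM r ((le_max_left _ _).trans hr)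
    · exact h' z hz hzM r ((le_max_right _ _).trans hr)
  · intro z hz
    obtain ⟨T, hT0, hT⟩ := ((eventually_ge_atTop (0 : ℝ)).and
      ((hMp z hz).eventually (hV'o.mem_nhds hpV'))).exists
    have hcont : Continuous fun w : X × ℝ => φ T w.1 := φ.continuous continuous_const continuous_fst
    refine ⟨_, mem_nhdsWithin_of_mem_nhds ((hV'o.preimage hcont).mem_nhds hT), T, hT0,
      fun w hw hwM t ht => ?_⟩
    have := hV' (budgetFlow ω φ T w) (hφ.budgetFlow_mem (hMR hwM) hT0) hw (t - T) (by linarith)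
    change φ (t - T) (φ T w.1) ∈ V at this
    rwa [← φ.map_add, sub_add_cancel] at this

/-- If a limit state converged to p, it would enter a stable neighbourhood of p, and so would the
approximating states. They would then stay near p, where p is the only fixed point, and converge to
p themselves. -/
theorem IsGradientLike.isClosed_viableTo_diff (hφ : IsGradientLike ω φ) (hfin : (fix φ).Finite)
    (hR : R ⊆ fix φ) (hcl : IsClosed (viableTo ω φ N R)) {p : X} (hp : p ∈ fix φ)
    (hmin : ∀ y ∉ fix φ, ∀ q ∈ R, Tendsto (fun t => φ t y) atBot (𝓝 p) →
      ¬ Tendsto (fun t => φ t y) atTop (𝓝 q)) : IsClosed (viableTo ω φ N (R \ {p})) := by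
  have hsub : viableTo ω φ N (R \ {p}) ⊆ viableTo ω φ N R := fun z hz =>
    ⟨hz.1, hz.2.imp fun q hq => ⟨hq.1.1, hq.2⟩⟩
  refine isClosed_of_closure_subset fun z hz => ?_
  obtain ⟨hzv, q, hq, hlim⟩ := closure_minimal hsub hcl hz
  by_cases hqp : q = p
  swap
  · exact ⟨hzv, q, ⟨hq, hqp⟩, hlim⟩
  exfalso
  subst hqp
  obtain ⟨V₀, hV₀, hV₀c, -, hiso⟩ := exists_isolating_nhds hfin q univ_mem
  obtain ⟨V', hV'o, hpV', hV'⟩ := hφ.exists_stable_nhds hfin hcl hp hmin hV₀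
  obtain ⟨T, hT0, hT⟩ := ((eventually_ge_atTop (0 : ℝ)).and
    (hlim.eventually (hV'o.mem_nhds hpV'))).exists
  have hcont : Continuous fun w : X × ℝ => φ T w.1 := φ.continuous continuous_const continuous_fst
  obtain ⟨w, hw1, hw2⟩ := mem_closure_iff.1 hz _ (hV'o.preimage hcont) hT
  obtain ⟨q', hq', hlim'⟩ := hw2.2
  have : q' ∈ V₀ := hV₀c.mem_of_tendsto ((tendsto_flow_iff φ w.1 q' T).2 hlim') <| by
    filter_upwards [eventually_ge_atTop 0] with t ht
    exact hV' (budgetFlow ω φ T w) (hφ.budgetFlow_mem (hsub hw2) hT0) hw1 t ht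
  exact hq'.2 (hiso q' (hR hq'.1) this)

end Budget

/-! ### Null-homotopic neighbourhoods in finite CW-complexes -/

section LocalContractibility

section Gluing

variable {A Y Z : Type*} [TopologicalSpace A] [TopologicalSpace Y] [TopologicalSpace Z]

/-- A continuous map from a compact set to a Hausdorff space is a quotient onto its image. Here this
holds relative to an arbitrary O: ultrafilters are lifted to K, and their limits in K map to the
right point. -/
theorem continuousOn_image_inter [T2Space Y] {K : Set A} (hK : IsCompact K) {p : A → Y}
    (hp : ContinuousOn p K) {G : Y → Z} {O : Set Y} (hG : ContinuousOn (G ∘ p) (K ∩ p ⁻¹' O)) :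
    ContinuousOn G (p '' K ∩ O) := by
  rintro y ⟨-, hyO⟩
  refine tendsto_iff_ultrafilter _ _ _ |>.2 fun 𝒰 h𝒰 => ?_
  have hS : p '' (K ∩ p ⁻¹' O) ∈ 𝒰 := by
    rw [Set.image_inter_preimage]
    exact h𝒰 self_mem_nhdsWithin
  let 𝒱 := Ultrafilter.ofComapInfPrincipal hS
  have h𝒱 : 𝒱.map p = 𝒰 := Ultrafilter.ofComapInfPrincipal_eq_of_map hS
  have h𝒱K : K ∩ p ⁻¹' O ∈ 𝒱 := Ultrafilter.ofComapInfPrincipal_mem hS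
  obtain ⟨a, haK, ha⟩ := hK.ultrafilter_le_nhds 𝒱
    (le_principal_iff.2 (mem_of_superset h𝒱K Set.inter_subset_left))
  have h1 : (𝒱 : Filter A) ≤ 𝓝[K] a :=
    le_inf ha (le_principal_iff.2 (mem_of_superset h𝒱K Set.inter_subset_left))
  have h2 : (𝒰 : Filter Y) ≤ 𝓝 (p a) := by
    rw [← h𝒱]
    exact (hp a haK).mono_left h1
  have hpa : p a = y := tendsto_nhds_unique (f := id) (l := (𝒰 : Filter Y)) h2
    (h𝒰.trans inf_le_left)
  have h3 : (𝒱 : Filter A) ≤ 𝓝[K ∩ p ⁻¹' O] a := le_inf ha (le_principal_iff.2 h𝒱K)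
  have h4 := (hG a ⟨haK, by rwa [Set.mem_preimage, hpa]⟩).mono_left h3
  rw [← h𝒱, ← hpa]
  exact h4

theorem continuousOn_union_inter {f : Y → Z} {s t O : Set Y} (hs : IsClosed s) (ht : IsClosed t)
    (hfs : ContinuousOn f (s ∩ O)) (hft : ContinuousOn f (t ∩ O)) :
    ContinuousOn f ((s ∪ t) ∩ O) := by
  have key : ∀ {r : Set Y}, IsClosed r → ContinuousOn f (r ∩ O) → ∀ x ∈ O,
      ContinuousWithinAt f (r ∩ O) x := fun {r} hr hf x hx => by
    by_cases hxr : x ∈ r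
    · exact hf x ⟨hxr, hx⟩
    · exact continuousWithinAt_of_notMem_closure fun h =>
        hxr (hr.closure_subset_iff.2 Set.inter_subset_left h)
  intro x hx
  rw [Set.union_inter_distrib_right]
  exact (key hs hfs x hx.2).union (key ht hft x hx.2)

end Gluing

section RadialPush

variable {E : Type*} [NormedAddCommGroup E] [NormedSpace ℝ E]

/-- The homotopy that pushes the points of a punctured ball radially to the unit sphere. -/
def radialPush (s : I) (z : E) : E := ((1 - s : ℝ) + s / ‖z‖) • z

theorem continuousOn_radialPush :
    ContinuousOn (fun q : E × I => radialPush q.2 q.1) {q | q.1 ≠ 0} := by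
  unfold radialPush
  refine ContinuousOn.smul (ContinuousOn.add (by fun_prop) (ContinuousOn.div (by fun_prop)
    (by fun_prop) fun q hq => norm_ne_zero_iff.2 hq)) (by fun_prop)

theorem radialPush_zero (z : E) : radialPush 0 z = z := by simp [radialPush]

theorem radialPush_of_norm_eq_one (s : I) {z : E} (hz : ‖z‖ = 1) : radialPush s z = z := by
  simp [radialPush, hz]

theorem norm_radialPush (s : I) {z : E} (hz : z ≠ 0) :
    ‖radialPush s z‖ = (1 - s) * ‖z‖ + s := by
  have h0 := s.2.1
  have h1 := s.2.2
  have hz' : 0 < ‖z‖ := norm_pos_iff.2 hz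
  rw [radialPush, norm_smul, Real.norm_of_nonneg (by have := sub_nonneg.2 h1; positivity)]
  field_simp

theorem radialPush_mem_closedBall (s : I) {z : E} (hz : z ≠ 0) (hz1 : ‖z‖ ≤ 1) :
    radialPush s z ∈ Metric.closedBall (0 : E) 1 := by
  rw [mem_closedBall_zero_iff, norm_radialPush s hz]
  have := s.2.1
  have := s.2.2
  nlinarith

theorem radialPush_one_mem_sphere {z : E} (hz : z ≠ 0) :
    radialPush 1 z ∈ Metric.sphere (0 : E) 1 := by
  rw [mem_sphere_zero_iff_norm, norm_radialPush 1 hz]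
  simp

end RadialPush

section CellAttachment

variable {X : Type u} [TopologicalSpace X]

/-- The inclusion of a subset into the whole space. -/
def inclusionMap (S : Set X) : C(S, X) := ⟨Subtype.val, continuous_subtype_val⟩

/-- Every point of `Y` has an open neighbourhood whose trace on `Y` is contractible in `X`. -/
def LocallyNullhomotopic (Y : Set X) : Prop :=
  ∀ x ∈ Y, ∃ V, IsOpen V ∧ x ∈ V ∧ (inclusionMap (V ∩ Y)).Nullhomotopic

open Topology.CWComplex Metric

variable [CWComplex (Set.univ : Set X)]

theorem nullhomotopic_openCell {n : ℕ} (i : cell (Set.univ : Set X) n) :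
    (inclusionMap (openCell n i)).Nullhomotopic := by
  let Φ := map n i
  have hsrc : Φ.source = ball 0 1 := source_eq n i
  have htgt : Φ.target = openCell n i := by
    rw [← Φ.image_source_eq_target, hsrc]
    rfl
  have hmem : ∀ y : openCell n i, (y : X) ∈ Φ.target := fun y => by
    rw [htgt]
    exact y.2
  have hsymm : ∀ y : openCell n i, Φ.symm y ∈ ball (0 : Fin n → ℝ) 1 := fun y => by
    rw [← hsrc]
    exact Φ.map_target (hmem y)
  have hcs : Continuous fun y : openCell n i => Φ.symm y := by
    have := continuousOn_symm n i
    rw [show (map n i).target = openCell n i from htgt] at this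
    exact this.comp_continuous continuous_subtype_val fun y => y.2
  refine ⟨Φ 0, ⟨⟨⟨fun q => Φ ((1 - (q.1 : ℝ)) • Φ.symm q.2), ?_⟩, fun y => ?_, fun y => ?_⟩⟩⟩
  · refine (continuousOn n i).comp_continuous
      (f := fun q : I × openCell n i => (1 - (q.1 : ℝ)) • Φ.symm q.2) ?_ fun q => ?_
    · exact (continuous_const.sub (continuous_subtype_val.comp continuous_fst)).smul
        (hcs.comp continuous_snd)
    · rw [mem_closedBall_zero_iff, norm_smul]
      have h1 := mem_ball_zero_iff.1 (hsymm q.2)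
      have h2 := q.1.2.1
      have h3 := q.1.2.2
      rw [Real.norm_of_nonneg (by linarith)]
      nlinarith [norm_nonneg (Φ.symm q.2)]
  · simpa [inclusionMap] using Φ.right_inv (hmem y)
  · simp

theorem iUnion_closedCell_eq_univ [Fintype (Σ n, cell (Set.univ : Set X) n)] :
    (⋃ e ∈ (Finset.univ : Finset (Σ n, cell (Set.univ : Set X) n)), closedCell e.1 e.2) =
      (Set.univ : Set X) := by
  refine Eq.trans ?_ (CWComplex.union (C := (Set.univ : Set X)))
  ext x
  simp

theorem compactSpace_of_finite_CWComplex [CWComplex.Finite (Set.univ : Set X)] :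
    CompactSpace X := by
  have := RelCWComplex.finite_cells_of_finite (C := (Set.univ : Set X))
  have := Fintype.ofFinite (Σ n, cell (Set.univ : Set X) n)
  refine ⟨?_⟩
  rw [← iUnion_closedCell_eq_univ]
  exact Finset.univ.isCompact_biUnion fun e _ => isCompact_closedCell

variable [T2Space X]

-- At a point of Y, the cell punctured at its centre is pushed radially onto its frontier, which
-- lies in Y. Points near x are thereby moved into the neighbourhood already known for Y. A point
-- outside Y lies in the open cell, which is contractible.
open Classical in
theorem LocallyNullhomotopic.union_closedCell {Y : Set X} (hY : IsClosed Y)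
    (h : LocallyNullhomotopic Y) {n : ℕ} (i : cell (Set.univ : Set X) n)
    (hfr : cellFrontier n i ⊆ Y) (hdisj : Disjoint (openCell n i) Y) :
    LocallyNullhomotopic (Y ∪ closedCell n i) := by
  let Φ := map n i
  have hsrc : Φ.source = ball 0 1 := source_eq n i
  have hΦc : ContinuousOn Φ (closedBall 0 1) := continuousOn n i
  have hballY : ∀ z ∈ ball (0 : Fin n → ℝ) 1, Φ z ∉ Y := fun z hz =>
    Set.disjoint_left.1 hdisj ⟨z, hz, rfl⟩
  have hsphY : ∀ z ∈ sphere (0 : Fin n → ℝ) 1, Φ z ∈ Y := fun z hz => hfr ⟨z, hz, rfl⟩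
  rintro x hx
  by_cases hxY : x ∈ Y
  swap
  · refine ⟨Yᶜ, hY.isOpen_compl, hxY, ?_⟩
    have heq : Yᶜ ∩ (Y ∪ closedCell n i) = openCell n i := by
      ext y
      rw [← cellFrontier_union_openCell_eq_closedCell]
      constructor
      · rintro ⟨h1, h2 | h2 | h2⟩
        exacts [absurd h2 h1, absurd (hfr h2) h1, h2]
      · exact fun hy => ⟨Set.disjoint_left.1 hdisj hy, Or.inr (Or.inr hy)⟩
    rw [heq]
    exact nullhomotopic_openCell i
  obtain ⟨V, hVo, hxV, hV⟩ := h x hxY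
  set c : X := Φ 0 with hc
  have hcY : c ∉ Y := hballY 0 (by simp)
  -- Only its values on Y and on the closed cell away from the centre c matter. The two descriptions
  -- agree on the frontier because `radialPush` fixes the unit sphere.
  let R : X × I → X := fun q => if q.1 ∈ Y then q.1 else Φ (radialPush q.2 (Φ.symm q.1))
  have hR : ∀ z ∈ closedBall (0 : Fin n → ℝ) 1, ∀ s, R (Φ z, s) = Φ (radialPush s z) := by
    intro z hz s
    rw [← sphere_union_ball] at hz
    rcases hz with hz | hz
    · simp only [R]
      rw [if_pos (hsphY z hz), radialPush_of_norm_eq_one s (mem_sphere_zero_iff_norm.1 hz)]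
    · simp only [R]
      rw [if_neg (hballY z hz), Φ.left_inv (hsrc ▸ hz)]
  have hRY : ∀ y ∈ Y, ∀ s, R (y, s) = y := fun y hy s => if_pos hy
  have hR0 : ∀ y ∈ Y ∪ closedCell n i, y ≠ c → R (y, 0) = y := by
    rintro y (hy | ⟨z, hz, rfl⟩) hyc
    · exact hRY y hy 0
    · change R (Φ z, 0) = Φ z
      rw [hR z hz, radialPush_zero]
  have hR1 : ∀ y ∈ Y ∪ closedCell n i, y ≠ c → R (y, 1) ∈ Y := by
    rintro y (hy | ⟨z, hz, rfl⟩) hyc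
    · rwa [hRY y hy]
    · change R (Φ z, 1) ∈ Y
      rw [hR z hz]
      exact hsphY _ (radialPush_one_mem_sphere fun h0 => hyc (by rw [h0]))
  have hRc : ContinuousOn R (((Y ∪ closedCell n i) ×ˢ Set.univ) ∩ {q | q.1 ≠ c}) := by
    rw [Set.union_prod]
    refine continuousOn_union_inter (hY.prod isClosed_univ)
      (isClosed_closedCell.prod isClosed_univ) ?_ ?_
    · exact continuousOn_fst.congr fun q hq => hRY q.1 hq.1.1 q.2
    · have himg : closedCell n i ×ˢ (Set.univ : Set I) =
          Prod.map Φ id '' (closedBall (0 : Fin n → ℝ) 1 ×ˢ (Set.univ : Set I)) := by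
        rw [Set.prodMap_image_prod, Set.image_id]
        rfl
      rw [himg]
      refine continuousOn_image_inter ((isCompact_closedBall _ _).prod isCompact_univ)
        (hΦc.prodMap continuousOn_id) ?_
      have h1 : ContinuousOn (fun q : (Fin n → ℝ) × I => Φ (radialPush q.2 q.1))
          (closedBall (0 : Fin n → ℝ) 1 ×ˢ (Set.univ : Set I) ∩
            Prod.map Φ id ⁻¹' {q : X × I | q.1 ≠ c}) := by
        have hne : ∀ q ∈ closedBall (0 : Fin n → ℝ) 1 ×ˢ (Set.univ : Set I) ∩
            Prod.map Φ id ⁻¹' {q : X × I | q.1 ≠ c}, q.1 ≠ 0 := fun q hq h0 =>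
          hq.2 (by simp [h0, hc])
        exact hΦc.comp (continuousOn_radialPush.mono hne) fun q hq =>
          radialPush_mem_closedBall q.2 (hne q hq) (mem_closedBall_zero_iff.1 hq.1.1)
      exact h1.congr fun q hq => hR q.1 hq.1.1 q.2
  have hRc1 : ContinuousOn (fun y => R (y, 1)) ((Y ∪ closedCell n i) ∩ {c}ᶜ) :=
    hRc.comp (f := fun y => (y, (1 : I))) (by fun_prop) fun y hy => ⟨⟨hy.1, trivial⟩, hy.2⟩
  obtain ⟨u, huo, hu⟩ := continuousOn_iff'.1 hRc1 V hVo
  have hmem : ∀ y ∈ (u ∩ {c}ᶜ) ∩ (Y ∪ closedCell n i), R (y, 1) ∈ V ∩ Y := fun y hy => by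
    have : y ∈ (fun y => R (y, 1)) ⁻¹' V ∩ ((Y ∪ closedCell n i) ∩ {c}ᶜ) := by
      rw [hu]
      exact ⟨hy.1.1, hy.2, hy.1.2⟩
    exact ⟨this.1, hR1 y hy.2 hy.1.2⟩
  refine ⟨u ∩ {c}ᶜ, huo.inter isOpen_compl_singleton, ⟨?_, fun hxc => hcY (hxc ▸ hxY)⟩, ?_⟩
  · have : x ∈ (fun y => R (y, 1)) ⁻¹' V ∩ ((Y ∪ closedCell n i) ∩ {c}ᶜ) :=
      ⟨by rwa [Set.mem_preimage, hRY x hxY], hx, fun hxc => hcY (hxc ▸ hxY)⟩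
    rw [hu] at this
    exact this.1
  let S : Set X := (u ∩ {c}ᶜ) ∩ (Y ∪ closedCell n i)
  let r₁ : C(S, ↑(V ∩ Y)) := ⟨fun y => ⟨R (y, 1), hmem y y.2⟩, Continuous.subtype_mk
    (hRc1.comp_continuous continuous_subtype_val fun y => ⟨y.2.2, y.2.1.2⟩) _⟩
  have hhom : (inclusionMap S).Homotopic ((inclusionMap (V ∩ Y)).comp r₁) :=
    ⟨⟨⟨fun q => R (q.2, q.1), hRc.comp_continuous (f := fun q : I × S => ((q.2 : X), q.1))
      (by fun_prop) fun q => ⟨⟨q.2.2.2, trivial⟩, q.2.2.1.2⟩⟩,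
      fun y => hR0 y y.2.2 y.2.1.2, fun y => rfl⟩⟩
  obtain ⟨x₀, hx₀⟩ := hV.comp_left r₁
  exact ⟨x₀, hhom.trans hx₀⟩

/-- Induction on the number of cells. Removing a cell of maximal dimension keeps the family closed
under passing to lower-dimensional cells; its frontier lies in the rest, and its interior meets none
of the remaining cells. -/
theorem locallyNullhomotopic_iUnion_closedCell (S : Finset (Σ n, cell (Set.univ : Set X) n))
    (hS : ∀ e ∈ S, ∀ m < e.1, ∀ j : cell (Set.univ : Set X) m, ⟨m, j⟩ ∈ S) :
    LocallyNullhomotopic (⋃ e ∈ S, closedCell e.1 e.2 : Set X) := by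
  classical
  induction hk : S.card generalizing S with
  | zero =>
    rw [Finset.card_eq_zero.1 hk]
    intro x hx
    simp at hx
  | succ k ih =>
    have hne : S.Nonempty := Finset.card_pos.1 (by lia)
    obtain ⟨e, heS, hmax⟩ := S.exists_max_image (fun e => e.1) hne
    have ih' := ih (S.erase e) (fun d hd m hm j => by
      have hd' := Finset.mem_erase.1 hd
      refine Finset.mem_erase.2 ⟨?_, hS d hd'.2 m hm j⟩
      rintro rfl
      exact absurd (hmax d hd'.2) (not_le.2 hm)) (by rw [Finset.card_erase_of_mem heS]; lia)
    have hcl : IsClosed (⋃ d ∈ S.erase e, closedCell d.1 d.2 : Set X) :=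
      isClosed_biUnion_finset fun d _ => isClosed_closedCell
    have := ih'.union_closedCell hcl e.2 ?_ ?_
    · convert this using 1
      conv_lhs => rw [← Finset.insert_erase heS]
      rw [Finset.set_biUnion_insert, Set.union_comm]
    · obtain ⟨J, hJ⟩ := cellFrontier_subset_finite_closedCell e.1 e.2
      refine hJ.trans ?_
      simp only [Set.iUnion_subset_iff]
      intro m hm j _
      refine Set.subset_biUnion_of_mem
        (u := fun d : Σ n, cell (Set.univ : Set X) n => closedCell d.1 d.2)
        (show (⟨m, j⟩ : Σ n, cell (Set.univ : Set X) n) ∈ S.erase e from ?_)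
      refine Finset.mem_erase.2 ⟨?_, hS e heS m hm j⟩
      rintro rfl
      exact lt_irrefl _ hm
    · simp only [Set.disjoint_iUnion_right]
      intro d hd
      have hd' := Finset.mem_erase.1 hd
      rw [← cellFrontier_union_openCell_eq_closedCell, Set.disjoint_union_right]
      refine ⟨?_, disjoint_openCell_of_ne (fun h => hd'.1 h.symm)⟩
      obtain ⟨J, hJ⟩ := cellFrontier_subset_finite_openCell d.1 d.2
      refine Disjoint.mono_right hJ ?_
      simp only [Set.disjoint_iUnion_right]
      intro m hm j _
      refine disjoint_openCell_of_ne fun h => ?_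
      have h1 : e.1 = m := congrArg Sigma.fst h
      have h2 := hmax d hd'.2
      lia

variable [CWComplex.Finite (Set.univ : Set X)]

theorem exists_open_nullhomotopic (x : X) :
    ∃ V : Set X, IsOpen V ∧ x ∈ V ∧ (inclusionMap V).Nullhomotopic := by
  have := RelCWComplex.finite_cells_of_finite (C := (Set.univ : Set X))
  have := Fintype.ofFinite (Σ n, cell (Set.univ : Set X) n)
  have h := locallyNullhomotopic_iUnion_closedCell
    (Finset.univ : Finset (Σ n, cell (Set.univ : Set X) n)) (by simp)
  rw [iUnion_closedCell_eq_univ] at h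
  obtain ⟨V, hV⟩ := h x trivial
  rw [Set.inter_univ] at hV
  exact ⟨V, hV⟩

end CellAttachment

end LocalContractibility

/-! ### Deformations, covers, and the removal of a fixed point -/

section Deformations

variable {X : Type u} [TopologicalSpace X]

/-- There is a homotopy from the identity to `u` whose tracks have the integrals `J`. -/
def Reach (ω : ClosedOneForm X) (u : C(X, X)) (J : X → ℝ) : Prop :=
  ∃ h : C(X × I, X), (∀ x, h (x, 0) = x) ∧ (∀ x, h (x, 1) = u x) ∧
    ∀ x, ω.integral (h.curry x) = J x

theorem Reach.id (ω : ClosedOneForm X) : Reach ω (ContinuousMap.id X) (fun _ => 0) :=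
  ⟨⟨Prod.fst, continuous_fst⟩, fun _ => rfl, fun _ => rfl, fun x => ω.integral_const x⟩

theorem Reach.continuous {ω : ClosedOneForm X} {u : C(X, X)} {J : X → ℝ} (h : Reach ω u J) :
    Continuous J := by
  obtain ⟨k, -, -, hk⟩ := h
  exact (ω.continuous_integral_curry k).congr hk

/-- The endpoint map of moving along a flow for a variable time after applying `u`. -/
def flowAfter (φ : Flow ℝ X) (τ : C(X, ℝ)) (u : C(X, X)) : C(X, X) :=
  ⟨fun x => φ (τ x) (u x), φ.continuous τ.continuous u.continuous⟩

theorem Reach.flowAfter {ω : ClosedOneForm X} {u : C(X, X)} {J : X → ℝ} (h : Reach ω u J)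
    (φ : Flow ℝ X) (τ : C(X, ℝ)) :
    Reach ω (flowAfter φ τ u) (fun x => J x + drop ω φ (u x) (τ x)) := by
  obtain ⟨k, hk0, hk1, hkJ⟩ := h
  let p : ℝ → I := Set.projIcc 0 1 zero_le_one
  have hp : Continuous p := continuous_projIcc
  have hp0 : ∀ r : ℝ, r ≤ 0 → p r = 0 := fun r hr => Set.projIcc_of_le_left _ hr
  have hp1 : ∀ r : ℝ, 1 ≤ r → p r = 1 := fun r hr => Set.projIcc_of_right_le _ hr
  have hpI : ∀ s : I, p s = s := fun s => Set.projIcc_val _ s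
  -- The given homotopy at double speed, followed by the flow for time τ. The clamp `p` freezes each
  -- half while the other one runs.
  let K : C(X × I, X) := ⟨fun q => φ (τ q.1 * p (2 * q.2 - 1)) (k (q.1, p (2 * q.2))),
    φ.continuous (by fun_prop) (by fun_prop)⟩
  have hI₁ : ∀ s : I, (s / 2 : ℝ) ∈ I := fun s => by constructor <;> linarith [s.2.1, s.2.2]
  have hI₂ : ∀ s : I, ((1 + s) / 2 : ℝ) ∈ I := fun s => by
    constructor <;> linarith [s.2.1, s.2.2]
  let θ₁ : C(I, I) := ⟨fun s => ⟨s / 2, hI₁ s⟩, Continuous.subtype_mk (by fun_prop) hI₁⟩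
  let θ₂ : C(I, I) := ⟨fun s => ⟨(1 + s) / 2, hI₂ s⟩, Continuous.subtype_mk (by fun_prop) hI₂⟩
  refine ⟨K, fun x => ?_, fun x => ?_, fun x => ?_⟩
  · simp only [K, ContinuousMap.coe_mk]
    rw [hp0 _ (by simp), hp0 _ (by simp), hk0]
    simp
  · simp only [K, ContinuousMap.coe_mk]
    rw [hp1 _ (by norm_num), hp1 _ (by norm_num), hk1]
    simp [LSForm.flowAfter]
  · change _ = J x + drop ω φ (u x) (τ x)
    rw [← hkJ x, drop]
    refine ω.integral_concat _ _ _ ⟨1 / 2, by norm_num, by norm_num⟩ θ₁ θ₂ ?_ ?_ ?_ ?_ ?_ ?_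
    · ext; simp [θ₁]
    · ext; simp [θ₁]
    · ext; simp [θ₂]
    · ext; simp [θ₂]
    · ext s
      have h1 : (2 : ℝ) * (s / 2) = s := by ring
      simp only [K, θ₁, ContinuousMap.comp_apply, ContinuousMap.curry_apply, ContinuousMap.coe_mk,
        h1]
      rw [hp0 _ (by linarith [s.2.2]), hpI]
      simp
    · ext s
      have h1 : (2 : ℝ) * ((1 + s) / 2) = 1 + s := by ring
      simp only [K, θ₂, ContinuousMap.comp_apply, ContinuousMap.curry_apply, ContinuousMap.coe_mk,
        h1, segment, orbitCurve]
      rw [hp1 (1 + s) (by linarith [s.2.1]), hk1, add_sub_cancel_left, hpI]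
      simp

theorem Reach.nullhomotopic {ω : ClosedOneForm X} {u : C(X, X)} {J : X → ℝ} (h : Reach ω u J)
    {G V : Set X} (hV : (inclusionMap V).Nullhomotopic) (hGV : ∀ x ∈ G, u x ∈ V) :
    (inclusionMap G).Nullhomotopic := by
  obtain ⟨k, hk0, hk1, -⟩ := h
  let g : C(G, V) := ⟨fun x => ⟨u x, hGV x x.2⟩, Continuous.subtype_mk (by fun_prop) _⟩
  have hhom : (inclusionMap G).Homotopic ((inclusionMap V).comp g) :=
    ⟨⟨⟨fun q => k (q.2, q.1), by fun_prop⟩, fun y => hk0 y, fun y => hk1 y⟩⟩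
  obtain ⟨x₀, hx₀⟩ := hV.comp_left g
  exact ⟨x₀, hhom.trans hx₀⟩

/-- `C` is covered by `m` open sets contractible in `X` and an open set on which some deformation
of `X` decreases `ω` by at least `N`. -/
def CoveredBy (ω : ClosedOneForm X) (N : ℝ) (m : ℕ) (C : Set X) : Prop :=
  ∃ (F : Set X) (G : Fin m → Set X), IsOpen F ∧ (∀ j, IsOpen (G j)) ∧ C ⊆ F ∪ ⋃ j, G j ∧
    (∀ j, (inclusionMap (G j)).Nullhomotopic) ∧
    ∃ (u : C(X, X)) (J : X → ℝ), Reach ω u J ∧ ∀ x ∈ F, J x ≤ -N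

/-- If a deformation of `X` moves the closed set `C` to states outside of `S`, then `C` admits a
cover with `m` contractible sets. -/
def CoverProperty (ω : ClosedOneForm X) (N : ℝ) (S : Set (X × ℝ)) (m : ℕ) : Prop :=
  ∀ (u : C(X, X)) (J : X → ℝ), Reach ω u J → (∀ x, J x ≤ 0) → ∀ C : Set X, IsClosed C →
    (∀ x ∈ C, (u x, N + J x) ∉ S) → CoveredBy ω N m C

variable {ω : ClosedOneForm X} {φ : Flow ℝ X} {N : ℝ} {R : Set X}

theorem CoveredBy.hasCover {m n : ℕ} (h : CoveredBy ω n m Set.univ) : HasCover ω m n := by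
  obtain ⟨F, G, hF, hG, hsub, hnull, u, J, ⟨k, hk0, -, hkJ⟩, hJ⟩ := h
  refine ⟨F, G, hF, hG, Set.univ_subset_iff.1 hsub, hnull,
    ⟨fun q => k (q.1, q.2), by fun_prop⟩, fun x => hk0 x, fun x => ?_⟩
  exact (hkJ x).trans_le (hJ x x.2)

theorem zeros_subset_fix (hφ : IsGradientLike ω φ) : zeros ω ⊆ fix φ := fun _ hp => hp φ hφ

/-- Outside `viable` the budget becomes negative at some time. This is an open condition that
persists at later times, so compactness of C gives a common time T, and flowing for time T after u
does the deformation. -/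
theorem IsGradientLike.coverProperty_viable [CompactSpace X] (hφ : IsGradientLike ω φ) :
    CoverProperty ω N (viable ω φ N) 0 := by
  intro u J hu hJ C hC hS
  have hcont : ∀ t, Continuous fun x => N + J x + drop ω φ (u x) t := fun t =>
    (continuous_const.add hu.continuous).add ((continuous_drop_left ω φ t).comp u.continuous)
  have hex : ∃ T : ℝ, ∀ x ∈ C, N + J x + drop ω φ (u x) T < 0 := by
    refine hC.isCompact.induction_on (p := fun D => ∃ T : ℝ, ∀ x ∈ D,
      N + J x + drop ω φ (u x) T < 0) ⟨0, by simp⟩ ?_ ?_ ?_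
    · rintro s t hst ⟨T, h⟩
      exact ⟨T, fun x hx => h x (hst hx)⟩
    · rintro s t ⟨T, h⟩ ⟨T', h'⟩
      refine ⟨max T T', ?_⟩
      rintro x (hx | hx)
      · linarith [h x hx, hφ.drop_antitone (u x) (le_max_left T T')]
      · linarith [h' x hx, hφ.drop_antitone (u x) (le_max_right T T')]
    · intro x hx
      have h1 := hS x hx
      simp only [viable, Set.mem_ofPred_eq, not_and, not_forall, not_le] at h1
      obtain ⟨t, ht, h2⟩ := h1 (by linarith [hJ x])
      exact ⟨_, mem_nhdsWithin_of_mem_nhds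
        ((isOpen_lt (hcont t) continuous_const).mem_nhds h2), t, fun y hy => hy⟩
  obtain ⟨T, hT⟩ := hex
  refine ⟨{x | N + J x + drop ω φ (u x) T < 0}, Fin.elim0, isOpen_lt (hcont T) continuous_const,
    fun j => j.elim0, fun x hx => Or.inl (hT x hx), fun j => j.elim0, _, _,
    hu.flowAfter φ (.const X T), fun x hx => ?_⟩
  have hx' : N + J x + drop ω φ (u x) T < 0 := hx
  simp only [ContinuousMap.const_apply]
  linarith

theorem tendsto_of_notMem_viableTo_diff {p : X} {z : X × ℝ} (hz : z ∈ viableTo ω φ N R)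
    (hz' : z ∉ viableTo ω φ N (R \ {p})) : Tendsto (fun t => φ t z.1) atTop (𝓝 p) := by
  obtain ⟨h1, q, hq, hlim⟩ := hz
  by_cases hqp : q = p
  · exact hqp ▸ hlim
  · exact absurd ⟨h1, q, ⟨hq, hqp⟩, hlim⟩ hz'

/-- A point moved by a gradient-like flow `ψ` has a neighbourhood that `ψ` pushes strictly below the
level of the point within a given neighbourhood. -/
theorem IsGradientLike.exists_push {ψ : Flow ℝ X} (hψ : IsGradientLike ω ψ) {q : X}
    (hq : q ∉ fix ψ) {U : ω.cover} {W : Set X} (hW : IsOpen W) (hqW : q ∈ W)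
    (hWU : W ⊆ (U.1 : Set X)) :
    ∃ (ε : ℝ) (B : Set X), 0 < ε ∧ IsOpen B ∧ q ∈ B ∧
      (∀ y ∈ B, ∀ s ∈ Set.Icc 0 ε, ψ s y ∈ W ∧ ω.val U (ψ s y) ≤ ω.val U y) ∧
      ∀ y ∈ B, ω.val U (ψ ε y) < ω.val U q := by
  have hc : Continuous fun s : ℝ => ψ s q := ψ.continuous continuous_id continuous_const
  have h0 : ∀ᶠ s in 𝓝 (0 : ℝ), ψ s q ∈ W :=
    (hW.preimage hc).mem_nhds (by simpa using hqW)
  obtain ⟨δ, hδ, hball⟩ := Metric.eventually_nhds_iff.1 h0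
  have hε : ∀ s ∈ Set.Icc 0 (δ / 2), ψ s q ∈ W := fun s hs => hball (by
    rw [Real.dist_eq, sub_zero, abs_of_nonneg hs.1]
    linarith [hs.2])
  have hlt : ω.val U (ψ (δ / 2) q) < ω.val U q :=
    hψ U q hq (δ / 2) (by positivity) fun s hs => hWU (hε s hs)
  have hB₁ : IsOpen {y | ∀ s ∈ Set.Icc 0 (δ / 2), ψ s y ∈ W} :=
    isOpen_forall_mem_compact ψ.cont' isCompact_Icc hW
  have hcont : ContinuousAt (fun y => ω.val U (ψ (δ / 2) y)) q :=
    ContinuousAt.comp (f := fun y => ψ (δ / 2) y)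
      (ω.continuousAt_val U (hWU (hε _ ⟨by positivity, le_rfl⟩)))
      (ψ.continuous continuous_const continuous_id).continuousAt
  obtain ⟨B₂, hB₂, hB₂o, hqB₂⟩ := eventually_nhds_iff.1 (hcont.eventually (gt_mem_nhds hlt))
  refine ⟨δ / 2, _, by positivity, hB₁.inter hB₂o, ⟨hε, hqB₂⟩, fun y hy s hs => ⟨hy.1 s hs, ?_⟩,
    fun y hy => hB₂ y hy.2⟩
  have h1 := drop_of_mem ω ψ U hs.1 (x := y)
    fun r hr => hWU (hy.1 r ⟨hr.1, hr.2.trans hs.2⟩)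
  linarith [hψ.drop_nonpos y hs.1]

variable [T2Space X] [CompactSpace X]

/-- If the states of a closed set avoid `viableTo ω φ N (R \ {p})`, then those in
`viableTo ω φ N R` are moved into a given neighbourhood of `p` by the flow. -/
theorem IsGradientLike.exists_time_forall_mem (hφ : IsGradientLike ω φ) (hfin : (fix φ).Finite)
    (hcl : IsClosed (viableTo ω φ N R)) {p : X} (hp : p ∈ fix φ)
    (hmin : ∀ y ∉ fix φ, ∀ q ∈ R, Tendsto (fun t => φ t y) atBot (𝓝 p) →
      ¬ Tendsto (fun t => φ t y) atTop (𝓝 q)) {V : Set X} (hV : V ∈ 𝓝 p)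
    {u : C(X, X)} {J : X → ℝ} (hJ : Continuous J) {C : Set X} (hC : IsClosed C)
    (hS : ∀ x ∈ C, (u x, N + J x) ∉ viableTo ω φ N (R \ {p})) :
    IsClosed (C ∩ (fun x => (u x, N + J x)) ⁻¹' viableTo ω φ N R) ∧
    ∃ T : ℝ, 0 ≤ T ∧ ∀ x ∈ C, (u x, N + J x) ∈ viableTo ω φ N R → φ T (u x) ∈ V := by
  have hσ : Continuous fun x => (u x, N + J x) := by fun_prop
  have hM : IsClosed (C ∩ (fun x => (u x, N + J x)) ⁻¹' viableTo ω φ N R) :=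
    hC.inter (hcl.preimage hσ)
  obtain ⟨T, hT0, hT⟩ := hφ.exists_forall_mem_nhds hfin hcl hp hmin hV (hM.isCompact.image hσ)
    (by rintro _ ⟨x, hx, rfl⟩; exact hx.2)
    (by rintro _ ⟨x, hx, rfl⟩; exact tendsto_of_notMem_viableTo_diff hx.2 (hS x hx.1))
  exact ⟨hM, T, hT0, fun x hxC hx => hT _ ⟨x, ⟨hxC, hx⟩, rfl⟩⟩

/-- The states in `viableTo ω φ N R` over C all tend to p and are in V at a common time T. The
points taken into V at time T form one null-homotopic open set, and the rest of C satisfies `hcov`.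
-/
theorem IsGradientLike.coverProperty_diff_succ (hφ : IsGradientLike ω φ) (hfin : (fix φ).Finite)
    (hcl : IsClosed (viableTo ω φ N R)) {p : X} (hp : p ∈ fix φ)
    (hmin : ∀ y ∉ fix φ, ∀ q ∈ R, Tendsto (fun t => φ t y) atBot (𝓝 p) →
      ¬ Tendsto (fun t => φ t y) atTop (𝓝 q)) {m : ℕ}
    (hcov : CoverProperty ω N (viableTo ω φ N R) m)
    (hloc : ∃ V : Set X, IsOpen V ∧ p ∈ V ∧ (inclusionMap V).Nullhomotopic) :
    CoverProperty ω N (viableTo ω φ N (R \ {p})) (m + 1) := by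
  intro u J hu hJ C hC hS
  obtain ⟨V, hVo, hpV, hV⟩ := hloc
  obtain ⟨-, T, hT0, hT⟩ := hφ.exists_time_forall_mem hfin hcl hp hmin (hVo.mem_nhds hpV)
    hu.continuous hC hS
  let G₀ : Set X := {x | φ T (u x) ∈ V}
  have hG₀ : IsOpen G₀ := hVo.preimage (φ.continuous continuous_const u.continuous)
  obtain ⟨F, G, hF, hG, hsub, hnull, hdef⟩ := hcov u J hu hJ (C ∩ G₀ᶜ)
    (hC.inter hG₀.isClosed_compl) fun x hx h => hx.2 (hT x hx.1 h)
  refine ⟨F, Fin.cons G₀ G, hF, fun j => ?_, fun x hx => ?_, fun j => ?_, hdef⟩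
  · refine Fin.cases ?_ (fun j => ?_) j
    · exact hG₀
    · simpa using hG j
  · by_cases hxG : x ∈ G₀
    · exact Or.inr (Set.mem_iUnion.2 ⟨0, hxG⟩)
    · rcases hsub ⟨hx, hxG⟩ with h | h
      · exact Or.inl h
      · obtain ⟨j, hj⟩ := Set.mem_iUnion.1 h
        exact Or.inr (Set.mem_iUnion.2 ⟨j.succ, by simpa using hj⟩)
  · refine Fin.cases ?_ (fun j => ?_) j
    · exact (hu.flowAfter φ (.const X T)).nullhomotopic hV fun x hx => hx
    · exact hnull j

/-- Trajectories starting close to a fixed point `q` cannot leave a given neighbourhood of `q` before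
descending below the level of `q`. -/
theorem IsGradientLike.exists_descent (hφ : IsGradientLike ω φ) (hfin : (fix φ).Finite) {q : X}
    (hq : q ∈ fix φ) {U : ω.cover} {B : Set X} (hB : IsOpen B) (hqB : q ∈ B)
    (hBU : B ⊆ (U.1 : Set X)) :
    ∃ V, IsOpen V ∧ q ∈ V ∧ V ⊆ B ∧ ∀ y ∈ V, (∀ t : ℝ, 0 ≤ t → φ t y ∈ B) ∨
      ∃ t : ℝ, 0 ≤ t ∧ (∀ s ∈ Set.Icc 0 t, φ s y ∈ B) ∧ ω.val U (φ t y) < ω.val U q := by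
  obtain ⟨V₀, hV₀, hV₀c, hV₀B, hiso⟩ := exists_isolating_nhds hfin q (hB.mem_nhds hqB)
  have hqV₀ : q ∈ interior V₀ := mem_interior_iff_mem_nhds.2 hV₀
  have hV₀U : V₀ ⊆ (U.1 : Set X) := hV₀B.trans hBU
  have hvc : ContinuousOn (ω.val U) V₀ := (ω.continuousOn_val U).mono hV₀U
  -- Exit points from V₀ that are not below the level of q. A backward orbit in V₀ ending in Z would
  -- emanate from q, so its end would lie strictly below that level.
  let Z : Set X := (V₀ ∩ ω.val U ⁻¹' Set.Ici (ω.val U q)) ∩ (interior V₀)ᶜ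
  have hZ : IsClosed Z := (hvc.preimage_isClosed_of_isClosed hV₀c isClosed_Ici).inter
    isOpen_interior.isClosed_compl
  obtain ⟨V, hVo, hqV, hV⟩ := exists_open_forall_notMem φ (B := V₀) (Z := Z) (O := interior V₀)
    (P := {q}) hV₀c.isCompact hZ isOpen_interior (Set.singleton_subset_iff.2 hqV₀)
    (fun t y hy => by rw [Set.mem_singleton_iff.1 hy, hq t]; rfl)
    (Set.disjoint_left.2 fun z hz => hz.2)
    (by
      intro z hz hback
      have hnf : z ∉ fix φ := fun hf => hz.2 (by rw [hiso z hf hz.1.1]; exact hqV₀)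
      have hdrop : ∀ s : ℝ, 0 ≤ s → ∀ r : ℝ, 0 ≤ r → r ≤ s →
          drop ω φ (φ (-s) z) r = ω.val U (φ (r - s) z) - ω.val U (φ (-s) z) := by
        intro s hs r hr hrs
        rw [drop_of_mem ω φ U hr, ← φ.map_add, ← sub_eq_add_neg]
        intro r' hr'
        rw [← φ.map_add, show r' + -s = -(s - r') by ring]
        exact hV₀U (hback _ (by linarith [hr'.2]))
      obtain ⟨b, hb⟩ := (hV₀c.isCompact.image_of_continuousOn hvc).bddAbove
      obtain ⟨p, hp, hlim⟩ := hφ.exists_tendsto_atBot hfin (x := z)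
        (b := max 0 (b - ω.val U z)) (by
          intro t
          rcases le_total 0 t with ht | ht
          · exact (hφ.drop_nonpos z ht).trans (le_max_left _ _)
          · refine le_max_of_le_right ?_
            have h1 := hdrop (-t) (by linarith) (-t) (by linarith) le_rfl
            have h2 := drop_add ω φ z t (-t)
            have h3 := hback (-t) (by linarith)
            rw [neg_neg, sub_self, φ.map_zero_apply] at h1
            rw [neg_neg] at h3
            rw [add_neg_cancel, drop_zero] at h2
            have h4 := hb ⟨_, h3, rfl⟩
            linarith)
      have hev : ∀ᶠ t in atBot, φ t z ∈ V₀ := by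
        filter_upwards [eventually_le_atBot 0] with t ht
        have h1 := hback (-t) (by linarith)
        rwa [neg_neg] at h1
      have hpq : p = q := hiso p hp (hV₀c.mem_of_tendsto hlim hev)
      subst hpq
      have hval : Tendsto (fun t => ω.val U (φ t z)) atBot (𝓝 (ω.val U p)) :=
        (ω.continuousAt_val U (hBU hqB)).tendsto.comp hlim
      have h1 : ω.val U (φ (-1) z) ≤ ω.val U p := by
        refine ge_of_tendsto hval ?_
        filter_upwards [eventually_le_atBot (-1)] with t ht
        have h2 := hdrop (-t) (by linarith) (-1 - t) (by linarith) (by linarith)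
        rw [neg_neg, show (-1 - t - -t : ℝ) = -1 by ring] at h2
        linarith [hφ.drop_nonpos (φ t z) (show 0 ≤ -1 - t by linarith)]
      have h2 := hdrop 1 zero_le_one 1 zero_le_one le_rfl
      rw [sub_self, φ.map_zero_apply] at h2
      have h3 := hφ.drop_neg (x := φ (-1) z) (by rwa [fix_flow_iff]) one_pos
      have h4 : ω.val U p ≤ ω.val U z := hz.1.2
      linarith)
  refine ⟨V ∩ interior V₀, hVo.inter isOpen_interior, ⟨hqV rfl, hqV₀⟩,
    fun y hy => hV₀B (interior_subset hy.2), fun y hy => ?_⟩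
  by_cases hall : ∀ t : ℝ, 0 ≤ t → φ t y ∈ B
  · exact Or.inl hall
  right
  push Not at hall
  obtain ⟨t, ht, hty⟩ := hall
  obtain ⟨r, hr, hr1, hr2⟩ := exists_first_exit (c := fun t => φ t y)
    (φ.continuous continuous_id continuous_const) isOpen_interior hV₀c interior_subset
    (by simpa using hy.2) ht (fun h => hty (hV₀B (interior_subset h)))
  refine ⟨r, hr.1, fun s hs => hV₀B (hr2 s hs), ?_⟩
  by_contra hcon
  exact hV y hy.1 r hr.1 hr2 ⟨⟨hr2 r ⟨hr.1, le_rfl⟩, not_lt.1 hcon⟩, hr1⟩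

/-- Near a fixed point `q` from which no trajectory leads back to `R`, the points below the level of
`q` do not belong to states in `viableTo ω φ N R`. -/
theorem IsGradientLike.exists_nhds_notMem_viableTo (hφ : IsGradientLike ω φ)
    (hfin : (fix φ).Finite) (hR : R ⊆ fix φ)
    (hcl : IsClosed (viableTo ω φ N R)) {q : X} (hq : q ∈ fix φ)
    (hmin : ∀ y ∉ fix φ, ∀ p ∈ R, Tendsto (fun t => φ t y) atBot (𝓝 q) →
      ¬ Tendsto (fun t => φ t y) atTop (𝓝 p)) {U : ω.cover} (hqU : q ∈ U.1) :
    ∃ W, IsOpen W ∧ q ∈ W ∧ W ⊆ (U.1 : Set X) ∧ (∀ p ∈ fix φ, p ∈ closure W → p = q) ∧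
      ∀ x ∈ W, ω.val U x < ω.val U q → ∀ a, (x, a) ∉ viableTo ω φ N R := by
  obtain ⟨V₀, hV₀, hV₀c, hV₀U, hiso⟩ := exists_isolating_nhds hfin q (U.1.isOpen.mem_nhds hqU)
  obtain ⟨V', hV'o, hqV', hV'⟩ := hφ.exists_stable_nhds hfin hcl hq hmin hV₀
  refine ⟨V' ∩ interior V₀, hV'o.inter isOpen_interior,
    ⟨hqV', mem_interior_iff_mem_nhds.2 hV₀⟩, fun x hx => hV₀U (interior_subset hx.2),
    fun p hp hpc => hiso p hp (closure_minimal (fun x hx => interior_subset hx.2) hV₀c hpc),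
    fun x hx hlt a hxa => ?_⟩
  have hstay : ∀ t : ℝ, 0 ≤ t → φ t x ∈ V₀ := hV' (x, a) hxa hx.1
  obtain ⟨p, hp, hlim⟩ := hxa.2
  have hpq : p = q := hiso p (hR hp) (hV₀c.mem_of_tendsto hlim
    ((eventually_ge_atTop 0).mono hstay))
  subst hpq
  have hval : Tendsto (fun t => ω.val U (φ t x)) atTop (𝓝 (ω.val U p)) :=
    (ω.continuousAt_val U hqU).tendsto.comp hlim
  refine absurd hlt (not_lt.2 (le_of_tendsto hval ?_))
  filter_upwards [eventually_ge_atTop 0] with t ht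
  have := drop_of_mem ω φ U ht fun s hs => hV₀U (hstay s hs.1)
  linarith [hφ.drop_nonpos x ht]

end Deformations

/-! ### Removing fixed points that are not zeros, and the final count -/

section Conclusion

variable {X : Type u} [TopologicalSpace X] [T2Space X] [CompactSpace X]
  {ω : ClosedOneForm X} {φ : Flow ℝ X} {N : ℝ} {R : Set X}

/-- A waiting time function: the states near `M` stay in `B`, and those in the shell `1/3 ≤ f ≤ 2/3`
descend below the level of `q` or exhaust their budget. -/
theorem IsGradientLike.exists_waiting_time (hφ : IsGradientLike ω φ) (hfin : (fix φ).Finite)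
    {q : X} (hqR : q ∈ R) {U : ω.cover} {B V : Set X}
    (hB : IsOpen B) (hBU : B ⊆ (U.1 : Set X)) (hBq : ∀ p ∈ fix φ, p ∈ closure B → p = q)
    (hVB : V ⊆ B)
    (hV : ∀ y ∈ V, (∀ t : ℝ, 0 ≤ t → φ t y ∈ B) ∨
      ∃ t : ℝ, 0 ≤ t ∧ (∀ s ∈ Set.Icc 0 t, φ s y ∈ B) ∧ ω.val U (φ t y) < ω.val U q)
    {u : C(X, X)} {J : X → ℝ} (hJc : Continuous J) (hJ : ∀ x, J x ≤ 0)
    {C : Set X} (hC : IsClosed C) {f : X → ℝ} (hf : Continuous f)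
    (hfV : ∀ x, f x ≤ 2 / 3 → u x ∈ V)
    (hfC : ∀ x ∈ C, 1 / 3 ≤ f x → (u x, N + J x) ∉ viableTo ω φ N R) :
    ∃ τ : C(X, ℝ), ∀ x, 0 ≤ τ x ∧ (f x ≤ 2 / 3 → φ (τ x) (u x) ∈ B) ∧
      (x ∈ C → 1 / 3 ≤ f x → f x ≤ 2 / 3 →
        ω.val U (φ (τ x) (u x)) < ω.val U q ∨ N + J x + drop ω φ (u x) (τ x) < 0) := by
  let Z : Set X := C ∩ f ⁻¹' Set.Icc (1 / 3) (2 / 3)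
  have hZ : IsClosed Z := hC.inter (isClosed_Icc.preimage hf)
  -- The admissible waiting times at x. They form an interval, since level and budget only decrease,
  -- and a locally constant choice exists; a partition of unity then gives a continuous choice.
  let S : X → Set ℝ := fun x => {t | 0 ≤ t ∧
    (f x ≤ 2 / 3 → ∀ s ∈ Set.Icc 0 t, φ s (u x) ∈ B) ∧
    (x ∈ Z → ω.val U (φ t (u x)) < ω.val U q ∨ N + J x + drop ω φ (u x) t < 0)}
  have hconv : ∀ x, Convex ℝ (S x) := by
    intro x
    refine Set.OrdConnected.convex ⟨?_⟩
    rintro a ⟨ha1, ha2, ha3⟩ c ⟨hc1, hc2, hc3⟩ b ⟨hab, hbc⟩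
    refine ⟨ha1.trans hab, fun hfx s hs => hc2 hfx s ⟨hs.1, hs.2.trans hbc⟩, fun hxZ => ?_⟩
    refine (ha3 hxZ).imp (fun h => ?_) fun h => ?_
    · have hst := hc2 hxZ.2.2
      have h1 := drop_of_mem ω φ U (x := φ a (u x)) (sub_nonneg.2 hab) fun s hs => by
        rw [← φ.map_add]
        exact hBU (hst _ ⟨by linarith [hs.1], by linarith [hs.2]⟩)
      rw [← φ.map_add, sub_add_cancel] at h1
      linarith [hφ.drop_nonpos (φ a (u x)) (sub_nonneg.2 hab)]
    · linarith [hφ.drop_antitone (u x) hab]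
  have hφc : ∀ t, Continuous fun x => φ t (u x) := fun t =>
    φ.continuous continuous_const u.continuous
  have hbud : ∀ t, Continuous fun x => N + J x + drop ω φ (u x) t := fun t =>
    (continuous_const.add hJc).add ((continuous_drop_left ω φ t).comp u.continuous)
  have hlocal : ∀ x, ∃ t : ℝ, ∀ᶠ y in 𝓝 x, t ∈ S y := by
    intro x
    by_cases hx : x ∈ Z
    swap
    · refine ⟨0, ?_⟩
      filter_upwards [hZ.isOpen_compl.mem_nhds hx] with y hy
      refine ⟨le_rfl, fun hfy s hs => ?_, fun h => absurd h hy⟩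
      rw [le_antisymm hs.2 hs.1, φ.map_zero_apply]
      exact hVB (hfV y hfy)
    obtain ⟨t, ht0, htB, ht⟩ : ∃ t : ℝ, 0 ≤ t ∧ (∀ s ∈ Set.Icc 0 t, φ s (u x) ∈ B) ∧
        (ω.val U (φ t (u x)) < ω.val U q ∨ N + J x + drop ω φ (u x) t < 0) := by
      -- If the trajectory stays in B and the budget lasts forever, the state is viable and
      -- converges to q ∈ R, contrary to `hfC`.
      rcases hV _ (hfV x hx.2.2) with hstay | ⟨t, ht0, htB, ht⟩
      · by_cases hneg : ∃ t : ℝ, 0 ≤ t ∧ N + J x + drop ω φ (u x) t < 0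
        · obtain ⟨t, ht0, ht⟩ := hneg
          exact ⟨t, ht0, fun s hs => hstay s hs.1, Or.inr ht⟩
        · push Not at hneg
          refine absurd ?_ (hfC x hx.1 hx.2.1)
          have hvia : (u x, N + J x) ∈ viable ω φ N :=
            ⟨by change N + J x ≤ N; linarith [hJ x], hneg⟩
          rw [← hφ.viableTo_fix hfin] at hvia
          obtain ⟨p, hp, hlim⟩ := hvia.2
          have hpq : p = q := hBq p hp (mem_closure_of_tendsto hlim
            ((eventually_ge_atTop 0).mono hstay))
          exact ⟨hvia.1, p, hpq ▸ hqR, hlim⟩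
      · exact ⟨t, ht0, htB, Or.inl ht⟩
    refine ⟨t, ?_⟩
    have h1 : ∀ᶠ y in 𝓝 x, ∀ s ∈ Set.Icc 0 t, φ s (u y) ∈ B :=
      ((isOpen_forall_mem_compact φ.cont' isCompact_Icc hB).preimage u.continuous).mem_nhds htB
    have h2 : ∀ᶠ y in 𝓝 x, ω.val U (φ t (u y)) < ω.val U q ∨
        N + J y + drop ω φ (u y) t < 0 := by
      rcases ht with ht | ht
      · have hcont : ContinuousAt (fun y => ω.val U (φ t (u y))) x :=
          ContinuousAt.comp (f := fun y => φ t (u y))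
            (ω.continuousAt_val U (hBU (htB t ⟨ht0, le_rfl⟩))) (hφc t).continuousAt
        exact (hcont.eventually (gt_mem_nhds ht)).mono fun y hy => Or.inl hy
      · exact ((hbud t).continuousAt.eventually (gt_mem_nhds ht)).mono fun y hy => Or.inr hy
    filter_upwards [h1, h2] with y hy1 hy2
    exact ⟨ht0, fun _ => hy1, fun _ => hy2⟩
  obtain ⟨τ, hτ⟩ := exists_continuous_forall_mem_convex_of_local_const hconv hlocal
  exact ⟨τ, fun x => ⟨(hτ x).1, fun h => (hτ x).2.1 h _ ⟨(hτ x).1, le_rfl⟩,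
    fun hxC h1 h2 => (hτ x).2.2 ⟨hxC, h1, h2⟩⟩⟩

/-- The flow φ first brings the bad states close to q. A cut-off push by ψ then takes them below the
level of q, where `viableTo ω φ N R` has no states near q. Where the push is only partial it might
fail to get below that level, so φ is first run for a waiting time that already achieves this or
exhausts the budget. -/
theorem IsGradientLike.coverProperty_diff (hφ : IsGradientLike ω φ) (hfin : (fix φ).Finite)
    (hR : R ⊆ fix φ) (hcl : IsClosed (viableTo ω φ N R)) {q : X} (hqR : q ∈ R)
    (hmin : ∀ y ∉ fix φ, ∀ p ∈ R, Tendsto (fun t => φ t y) atBot (𝓝 q) →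
      ¬ Tendsto (fun t => φ t y) atTop (𝓝 p)) {m : ℕ}
    (hcov : CoverProperty ω N (viableTo ω φ N R) m) {ψ : Flow ℝ X} (hψ : IsGradientLike ω ψ)
    (hqψ : q ∉ fix ψ) : CoverProperty ω N (viableTo ω φ N (R \ {q})) m := by
  intro u₀ J₀ hu₀ hJ₀ C hC hS
  have hq := hR hqR
  obtain ⟨U₁, hU₁, hqU₁⟩ := ω.covers q
  let U : ω.cover := ⟨U₁, hU₁⟩
  have hqU : q ∈ U.1 := hqU₁
  obtain ⟨W, hWo, hqW, hWU, hWq, hW⟩ :=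
    hφ.exists_nhds_notMem_viableTo hfin hR hcl hq hmin hqU
  obtain ⟨ε, B, hε, hBo, hqB, hpush, hpushlt⟩ := hψ.exists_push hqψ hWo hqW hWU
  have hBW : B ⊆ W := fun y hy => by
    simpa using (hpush y hy 0 ⟨le_rfl, hε.le⟩).1
  obtain ⟨V, hVo, hqV, hVB, hV⟩ := hφ.exists_descent hfin hq hBo hqB (hBW.trans hWU)
  obtain ⟨hM, T, hT0, hT⟩ := hφ.exists_time_forall_mem hfin hcl hq hmin (hVo.mem_nhds hqV)
    hu₀.continuous hC hS
  let u : C(X, X) := flowAfter φ (.const X T) u₀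
  let J : X → ℝ := fun x => J₀ x + drop ω φ (u₀ x) T
  have hu : Reach ω u J := hu₀.flowAfter φ (.const X T)
  have hJ : ∀ x, J x ≤ 0 := fun x => by
    have := hφ.drop_nonpos (u₀ x) hT0
    have := hJ₀ x
    change J₀ x + drop ω φ (u₀ x) T ≤ 0
    linarith
  have hstate : ∀ x, (u₀ x, N + J₀ x) ∉ viableTo ω φ N R → (u x, N + J x) ∉ viableTo ω φ N R := by
    intro x hx h
    refine hx (hφ.mem_of_budgetFlow_mem hT0 ?_ (by change N + J₀ x ≤ N; linarith [hJ₀ x]))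
    convert h using 1
    exact Prod.ext rfl (add_assoc _ _ _)
  have hO : IsClosed (u ⁻¹' V)ᶜ := (hVo.preimage u.continuous).isClosed_compl
  -- f vanishes at the bad points and equals 1 where u leaves V.
  obtain ⟨f, hf0, hf1, hf01⟩ := exists_continuous_zero_one_of_isClosed hM hO
    (Set.disjoint_left.2 fun x hx hx' => hx' (hT x hx.1 hx.2))
  have hfV : ∀ x, f x ≤ 2 / 3 → u x ∈ V := fun x hx => by
    by_contra hcon
    have h1 : f x = 1 := hf1 hcon
    rw [h1] at hx
    norm_num at hx
  have hfM : ∀ x ∈ C, 1 / 3 ≤ f x → (u x, N + J x) ∉ viableTo ω φ N R := fun x hxC hx => by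
    refine hstate x fun h => ?_
    have h1 : f x = 0 := hf0 ⟨hxC, h⟩
    rw [h1] at hx
    norm_num at hx
  obtain ⟨τ, hτ⟩ := hφ.exists_waiting_time (N := N) hfin hqR hBo (hBW.trans hWU)
    (fun p hp hpB => hWq p hp (closure_mono hBW hpB)) hVB hV hu.continuous hJ hC f.continuous
    hfV hfM
  -- The pushing time is ε for f ≤ 1/3 and 0 for f ≥ 2/3.
  let χ : C(X, ℝ) := ⟨fun x => ε * max 0 (min 1 (2 - 3 * f x)), by fun_prop⟩
  have hχ : ∀ x, χ x ∈ Set.Icc 0 ε := fun x => by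
    refine ⟨mul_nonneg hε.le (le_max_left _ _), ?_⟩
    exact mul_le_of_le_one_right hε.le (max_le zero_le_one (min_le_left _ _))
  have hχ0 : ∀ x, 2 / 3 < f x → χ x = 0 := fun x hx => by
    have : min 1 (2 - 3 * f x) ≤ 0 := (min_le_right _ _).trans (by linarith)
    simp [χ, max_eq_left this]
  have hχ1 : ∀ x, f x < 1 / 3 → χ x = ε := fun x hx => by
    have : (1 : ℝ) ≤ 2 - 3 * f x := by linarith
    simp [χ, min_eq_left this]
  have hu2 := hu.flowAfter φ τ
  refine hcov _ _ (hu2.flowAfter ψ χ) (fun x => ?_) C hC fun x hxC hx => ?_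
  · have h1 := hφ.drop_nonpos (u x) (hτ x).1
    have h2 := hψ.drop_nonpos (flowAfter φ τ u x) (hχ x).1
    linarith [hJ x]
  have hu3 : flowAfter ψ χ (flowAfter φ τ u) x = ψ (χ x) (φ (τ x) (u x)) := rfl
  have hu2x : flowAfter φ τ u x = φ (τ x) (u x) := rfl
  rw [hu3, hu2x] at hx
  rcases lt_or_ge (2 / 3) (f x) with hfx | hfx
  · rw [hχ0 x hfx, ψ.map_zero_apply, drop_zero, add_zero] at hx
    refine hfM x hxC (by linarith) (hφ.mem_of_budgetFlow_mem (hτ x).1 ?_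
      (by change N + J x ≤ N; linarith [hJ x]))
    convert hx using 1
    exact Prod.ext rfl (add_assoc _ _ _)
  have hB := (hτ x).2.1 hfx
  have hp := hpush _ hB _ (hχ x)
  rcases lt_or_ge (f x) (1 / 3) with hfx' | hfx'
  · rw [hχ1 x hfx'] at hx hp
    exact hW _ hp.1 (hpushlt _ hB) _ hx
  · rcases (hτ x).2.2 hxC hfx' hfx with h | h
    · exact hW _ hp.1 (hp.2.trans_lt h) _ hx
    · have h1 := (viable_subset hx.1).2.1
      have h2 := hψ.drop_nonpos (φ (τ x) (u x)) (hχ x).1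
      simp only at h1
      linarith

theorem IsGradientLike.coveredBy_univ (hφ : IsGradientLike ω φ) (hfin : (fix φ).Finite)
    (hno : ¬ HasHomoclinicCycle φ)
    (hloc : ∀ p : X, ∃ V : Set X, IsOpen V ∧ p ∈ V ∧ (inclusionMap V).Nullhomotopic) :
    CoveredBy ω N (zeros ω).ncard Set.univ := by
  have hzfin : (zeros ω).Finite := hfin.subset (zeros_subset_fix hφ)
  -- The number of sets spent so far is the number of zeros already deleted from R.
  have key : ∀ (n : ℕ) (R : Set X), R.ncard = n → R ⊆ fix φ → IsClosed (viableTo ω φ N R) →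
      CoverProperty ω N (viableTo ω φ N R) (zeros ω \ R).ncard →
      CoverProperty ω N (viableTo ω φ N ∅) (zeros ω).ncard := by
    intro n
    induction n with
    | zero =>
      intro R hn hR _ h
      rw [Set.ncard_eq_zero (hfin.subset hR)] at hn
      subst hn
      simpa using h
    | succ n ih =>
      intro R hn hR hcl h
      have hRfin := hfin.subset hR
      have hne : R.Nonempty := (Set.ncard_pos hRfin).1 (by lia)
      obtain ⟨p, hp, hmin⟩ := exists_minimal_of_not_hasHomoclinicCycle hno hRfin hne
      refine ih (R \ {p}) (by rw [Set.ncard_sdiff_singleton_of_mem hp, hn]; rfl)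
        (Set.sdiff_subset.trans hR) (hφ.isClosed_viableTo_diff hfin hR hcl (hR hp) hmin) ?_
      by_cases hpz : p ∈ zeros ω
      · have h1 : zeros ω \ (R \ {p}) = insert p (zeros ω \ R) := by
          ext x
          by_cases hx : x = p
          · subst hx; simp [hpz]
          · simp [hx]
        rw [h1, Set.ncard_insert_of_notMem (fun hm => hm.2 hp) hzfin.sdiff]
        exact hφ.coverProperty_diff_succ hfin hcl (hR hp) hmin h (hloc p)
      · have h1 : zeros ω \ (R \ {p}) = zeros ω \ R := by
          ext x
          by_cases hx : x = p
          · subst hx; simp [hpz]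
          · simp [hx]
        rw [h1]
        simp only [zeros, Set.mem_ofPred_eq, not_forall] at hpz
        obtain ⟨ψ, hψ, hpψ⟩ := hpz
        exact hφ.coverProperty_diff hfin hR hcl hp hmin h hψ hpψ
  have hstart : CoverProperty ω N (viableTo ω φ N (fix φ)) (zeros ω \ fix φ).ncard := by
    rw [hφ.viableTo_fix hfin, Set.sdiff_eq_empty.2 (zeros_subset_fix hφ), Set.ncard_empty]
    exact hφ.coverProperty_viable
  have hcl : IsClosed (viableTo ω φ N (fix φ)) := by
    rw [hφ.viableTo_fix hfin]
    exact isClosed_viable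
  refine key _ (fix φ) rfl subset_rfl hcl hstart (ContinuousMap.id X) _ (Reach.id ω)
    (fun _ => le_rfl) Set.univ isClosed_univ fun x _ h => ?_
  obtain ⟨p, hp, -⟩ := h.2
  exact hp

theorem IsGradientLike.cat_le_encard_zeros (hφ : IsGradientLike ω φ) (hfin : (fix φ).Finite)
    (hno : ¬ HasHomoclinicCycle φ)
    (hloc : ∀ p : X, ∃ V : Set X, IsOpen V ∧ p ∈ V ∧ (inclusionMap V).Nullhomotopic)
    {ξ : H1 X} (hξ : ω.Represents ξ) : cat ξ ≤ (zeros ω).encard := by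
  refine sInf_le ⟨(zeros ω).ncard, ?_, ω, hξ, fun n _ => ?_⟩
  · exact ((hfin.subset (zeros_subset_fix hφ)).cast_ncard_eq).symm
  · exact (hφ.coveredBy_univ hfin hno hloc).hasCover

end Conclusion

end LSForm

end

theorem mainTheorem2 {X : Type*} [TopologicalSpace X] [T2Space X]
    [Topology.CWComplex (Set.univ : Set X)] [Topology.CWComplex.Finite (Set.univ : Set X)]
    (ω : LSForm.ClosedOneForm X) (ξ : LSForm.H1 X) (hξ : ω.Represents ξ) :
    (∀ (k : ℕ) (p : Fin k → X), Function.Injective p → LSForm.zeros ω = Set.range p →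
      (k : ℕ∞) < LSForm.cat ξ →
      ∀ φ : Flow ℝ X, LSForm.IsGradientLike ω φ → LSForm.fix φ = Set.range p →
        LSForm.HasHomoclinicCycle φ) ∧
    ((∃ φ : Flow ℝ X, LSForm.IsGradientLike ω φ ∧ (LSForm.fix φ).Finite ∧
        ¬ LSForm.HasHomoclinicCycle φ) →
      LSForm.cat ξ ≤ (LSForm.zeros ω).encard) := by
  have := LSForm.compactSpace_of_finite_CWComplex (X := X)
  have hloc := LSForm.exists_open_nullhomotopic (X := X)
  refine ⟨fun k p hp hz hk φ hφ hfix => ?_, fun ⟨φ, hφ, hfin, hno⟩ =>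
    hφ.cat_le_encard_zeros hfin hno hloc hξ⟩
  by_contra hno
  have hle := hφ.cat_le_encard_zeros (hfix ▸ Set.finite_range p) hno hloc hξ
  rw [hz, ← Set.image_univ, hp.encard_image, Set.encard_univ, ENat.card_eq_coe_fintype_card,
    Fintype.card_fin] at hle
  exact absurd hk (not_lt.2 hle)
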